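/- **Conventions.** $\sigma_x,\sigma_y,\sigma_z$ are the Pauli matrices, and $\vec v\cdot\vec\sigma = v_x\sigma_x+v_y\sigma_y+v_z\sigma_z$. Spaces of homomorphisms to $SU(2)$ carry the topology of pointwise convergence, and spaces of conjugacy classes (under conjugation by $SU(2)$) the quotient topology. Values $\rho(A),\rho(B),\dots$ are written $A,B,\dots$. *The space $R(T^2,2)$.* This is the space of conjugacy classes of homomorphisms $\rho:\pi_1(T^2-\{p_1,p_2\})=\langle A,B,a,b\mid ABA^{-1}B^{-1}ab=1\rangle\to SU(2)$ with $\operatorname{tr} a=\operatorname{tr} b=0$. Let $\mu([\rho])=\tfrac12\operatorname{tr}(ABA^{-1}B^{-1})$, $P_4=\mu^{-1}([-1,1))$ and $P_3=\mu^{-1}(1)$. A point of $P_4$ has a unique representative with $$A=r\cos\alpha+i\sigma_x\sqrt{1-r^2}+i\sigma_z r\sin\alpha,\qquad B=\cos\beta+i\sigma_z\sin\beta,\qquad \alpha\in[0,2\pi],\ \beta\in(0,\pi),\ r\in[0,1),$$ and for it we write $a=i\hat a\cdot\vec\sigma$, $b=i\hat b\cdot\vec\sigma$; this defines $\hat a,\hat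 b\in S^2$. A point of $P_3$ is said to have coordinates $(\alpha,\beta,\gamma)$ (not unique) if it has a representative with $$A=\cos\alpha+i\sigma_z\sin\alpha,\quad B=\cos\beta+i\sigma_z\sin\beta,\quad a=i\sigma_x\cos\gamma+i\sigma_z\sin\gamma,\quad b=a^{-1}.$$ The pillowcase $P_3\cap\{\gamma=0\}$ is the set of points of $P_3$ having coordinates of the form $(\alpha,\beta,0)$. *The space $R_\pi^\natural(S^1\times D^2,A_1)$.* Fix $\epsilon>0$. This is the space of conjugacy classes of homomorphisms $\rho$ to $SU(2)$ from the group $\langle A,B,a,b,h,w\mid hwaB=aBh,\ b=ha^{-1}w^{-1}h^{-1}\rangle$ (generators of $\pi_1$ of the complement in $S^1\times D^2$ of an unknotted arc $A_1$, a loop $H$ around it, an arc $W$ joining them, and a perturbation loop $P$ with longitude $\lambda_P=h^{-1}A$ and meridian $\mu_P=B$) such that $\operatorname{tr}a=\operatorname{tr}b=\operatorname{tr}h=0$, $w=-1$, and the following holonomy condition holds: whenever $\rho(\lambda_P)=\cos\phi+i\hat r\cdot\vec\sigma\sin\phi$ with $\phi\in\mathbb R$ and $\hat r\in S^2$, then $\rho(\mu_P)=\cos\nu+i\hat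 r\cdot\vec\sigma\sin\nu$ with $\nu=\epsilon\sin\phi$. (In particular $\rho(\lambda_P)$ and $\rho(\mu_P)$ commute, and the matrices $A,B,a,b$ then satisfy $ABA^{-1}B^{-1}ab=1$.) Sending $[\rho]$ to the class of the representation of $\pi_1(T^2-\{p_1,p_2\})$ with the same values on $A,B,a,b$ defines a map $R_\pi^\natural(S^1\times D^2,A_1)\to R(T^2,2)$, whose image is denoted $L_s$. **Theorem.** There is $\epsilon_0>0$ such that for all $0<\epsilon<\epsilon_0$ the following hold. Let $(x,y,z)=(\sin\phi\cos\theta,\sin\phi\sin\theta,\cos\phi)$, $\phi\in[0,\pi]$, $\theta\in[0,2\pi]$, be spherical coordinates on $S^2$, and put $\nu=\epsilon\sin\phi$, $D=\cos^2\nu+\sin^2\nu\sin^2\theta$. 1. There is a homeomorphism $S^2\to R_\pi^\natural(S^1\times D^2,A_1)$ given by $(\phi,\theta)\mapsto[\rho]$, where $\rho$ is specified by $$a=i\sigma_z,\qquad b=-ha^{-1}h^{-1}=-D^{-1}\bigl(i\sigma_x\sin2\nu\sin\theta+i\sigma_z(\cos^2\nu-\sin^2\nu\sin^2\theta)\bigr),$$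 $$A=h\bigl(\cos\phi+i\sin\phi(\sigma_x\cos\theta+\sigma_y\sin\theta)\bigr),\qquad B=\cos\nu+i\sin\nu(\sigma_x\cos\theta+\sigma_y\sin\theta),$$ $$h=D^{-1/2}(i\sigma_x\cos\nu-i\sigma_z\sin\nu\sin\theta),\qquad w=-1.$$ Let $L_s(\phi,\theta)\in R(T^2,2)$ be the image of the point with coordinates $(\phi,\theta)$. 2. The map $R_\pi^\natural(S^1\times D^2,A_1)\to R(T^2,2)$ is injective except that the north pole ($\phi=0$) and the south pole ($\phi=\pi$) have the same image: two distinct points have the same image if and only if they are the two poles. 3. Every representation in $L_s$ is nonabelian. 4. Points with $y\neq0$ are mapped into $P_4$. For $\phi\in(0,\pi)$ and $\theta\in(0,\pi)$ (sign $s=1$) or $\theta\in(\pi,2\pi)$ (sign $s=-1$), $$\hat a(L_s(\phi,\theta))=-s\,(\sin(\phi+\nu),\cos(\phi+\nu),0),$$ $$\hat b_x=sD^{-1}\bigl(\cos^2\nu\cos^2\theta\sin(\phi+\nu)+\sin^2\theta\sin(\phi-\nu)\bigr),$$ $$\hat b_y=sD^{-1}\bigl(\cos^2\nu\cos^2\theta\cos(\phi+\nu)+\sin^2\theta\cos(\phi-\nu)\bigr),$$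 $$\hat b_z=-\tfrac12D^{-1}\sin(2\nu)\sin(2\theta).$$ 5. Points with $y=0$ are mapped into the pillowcase $P_3\cap\{\gamma=0\}$. For $\phi\in[0,\pi]$, $L_s(\phi,0)$ has coordinates $(\alpha,\beta,\gamma)=(\phi+\pi/2,\nu,0)$ and $L_s(\phi,\pi)$ has coordinates $(\phi-\pi/2,\nu,0)$. Both poles are mapped to the point with coordinates $(\pi/2,0,0)$. -/

import Mathlib

open Matrix

namespace PerturbedCharVar

/-! ### `SU(2)`, Pauli matrices -/

/-- The topological group `SU(2)`. -/
abbrev SU2 : Type := Matrix.specialUnitaryGroup (Fin 2) ℂ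

/-- The Pauli matrix `σ_x`. -/
def sigmaX : Matrix (Fin 2) (Fin 2) ℂ := !![0, 1; 1, 0]

/-- The Pauli matrix `σ_y`. -/
def sigmaY : Matrix (Fin 2) (Fin 2) ℂ := !![0, -Complex.I; Complex.I, 0]

/-- The Pauli matrix `σ_z`. -/
def sigmaZ : Matrix (Fin 2) (Fin 2) ℂ := !![1, 0; 0, -1]

/-- The matrix `t + i (v · σ)`, for a real number `t` and a vector `v ∈ ℝ³`. -/
noncomputable def quat (t : ℝ) (v : Fin 3 → ℝ) : Matrix (Fin 2) (Fin 2) ℂ :=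
  (t : ℂ) • (1 : Matrix (Fin 2) (Fin 2) ℂ) +
    Complex.I • ((v 0 : ℂ) • sigmaX + (v 1 : ℂ) • sigmaY + (v 2 : ℂ) • sigmaZ)

/-- `v` is a unit vector of Euclidean `ℝ³`. -/
def IsUnitVec (v : Fin 3 → ℝ) : Prop := v 0 ^ 2 + v 1 ^ 2 + v 2 ^ 2 = 1

/-! ### Character varieties of a group -/

/-- Homomorphisms `ρ : G → SU(2)` subject to a condition `C`. -/
structure Rep (G : Type) [Group G] (C : (G →* SU2) → Prop) : Type where
  hom : G →* SU2
  cond : C hom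

/-- The topology of pointwise convergence on representations. -/
noncomputable instance Rep.instTopologicalSpace (G : Type) [Group G] (C : (G →* SU2) → Prop) :
    TopologicalSpace (Rep G C) :=
  TopologicalSpace.induced (fun (ρ : Rep G C) (x : G) => ρ.hom x) inferInstance

/-- Two representations are conjugate if they differ by conjugation by an element of `SU(2)`. -/
def Rep.conjSetoid (G : Type) [Group G] (C : (G →* SU2) → Prop) : Setoid (Rep G C) where
  r ρ ρ' := ∃ g : SU2, ∀ x : G, ρ'.hom x = g * ρ.hom x * g⁻¹
  iseqv :=
    { refl := fun ρ => ⟨1, fun x => by simp⟩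
      symm := by
        rintro ρ ρ' ⟨g, hg⟩
        exact ⟨g⁻¹, fun x => by rw [hg x]; group⟩
      trans := by
        rintro ρ ρ' ρ'' ⟨g, hg⟩ ⟨k, hk⟩
        exact ⟨k * g, fun x => by rw [hk x, hg x]; group⟩ }

/-- The space of conjugacy classes of homomorphisms `ρ : G → SU(2)` satisfying the condition `C`,
with the quotient topology. -/
def CharVar (G : Type) [Group G] (C : (G →* SU2) → Prop) : Type :=
  Quotient (Rep.conjSetoid G C)

noncomputable instance CharVar.instTopologicalSpace (G : Type) [Group G] (C : (G →* SU2) → Prop) :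
    TopologicalSpace (CharVar G C) :=
  inferInstanceAs (TopologicalSpace (Quotient (Rep.conjSetoid G C)))

/-- The conjugacy class `[ρ]`. -/
def Rep.cls {G : Type} [Group G] {C : (G →* SU2) → Prop} (ρ : Rep G C) : CharVar G C :=
  Quotient.mk (Rep.conjSetoid G C) ρ

/-- A conjugacy class is nonabelian if its representatives have nonabelian image. -/
def CharVar.IsNonabelian {G : Type} [Group G] {C : (G →* SU2) → Prop} (x : CharVar G C) : Prop :=
  ∀ ρ : Rep G C, ρ.cls = x → ∃ g k : G, ρ.hom g * ρ.hom k ≠ ρ.hom k * ρ.hom g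

/-- `U` has trace zero. -/
def IsTraceless (U : SU2) : Prop := Matrix.trace (U : Matrix (Fin 2) (Fin 2) ℂ) = 0

/-! ### The twice-punctured torus -/

/-- The generators of `π₁(T² - {p₁, p₂})`: fundamental cycles `A`, `B` and loops `a`, `b` around
the punctures. -/
inductive TorusGen : Type
  | A | B | a | b

/-- The relator of `⟨A, B, a, b ∣ [A,B] a b = 1⟩`. -/
def torusRels : Set (FreeGroup TorusGen) :=
  {FreeGroup.of TorusGen.A * FreeGroup.of TorusGen.B *
    (FreeGroup.of TorusGen.A)⁻¹ * (FreeGroup.of TorusGen.B)⁻¹ *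
    FreeGroup.of TorusGen.a * FreeGroup.of TorusGen.b}

/-- `π₁(T² - {p₁, p₂}) = ⟨A, B, a, b ∣ [A,B] a b = 1⟩`. -/
abbrev TorusGroup : Type := PresentedGroup torusRels

/-- The class of a generator in `π₁(T² - {p₁, p₂})`. -/
def tg (x : TorusGen) : TorusGroup := PresentedGroup.of x

/-- Loops around the punctures go to traceless matrices. -/
def TorusCond (ρ : TorusGroup →* SU2) : Prop :=
  IsTraceless (ρ (tg .a)) ∧ IsTraceless (ρ (tg .b))

/-- Representations of `π₁(T² - {p₁, p₂})` taking loops around the punctures to traceless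
matrices. -/
abbrev TorusRep : Type := Rep TorusGroup TorusCond

/-- The character variety `R(T², 2)`. -/
abbrev RT22 : Type := CharVar TorusGroup TorusCond

/-- The map `μ : R(T², 2) → [-1, 1]`, `[ρ] ↦ (1/2) tr [A, B]`. -/
noncomputable def mu : RT22 → ℝ :=
  Quotient.lift
    (fun ρ : TorusRep =>
      (1 / 2 : ℝ) * (Matrix.trace
        ((ρ.hom (tg .A * tg .B * (tg .A)⁻¹ * (tg .B)⁻¹) : SU2) : Matrix (Fin 2) (Fin 2) ℂ)).re)
    (by
      rintro ρ ρ' ⟨g, hg⟩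
      have h : Matrix.trace ((g * ρ.hom (tg .A * tg .B * (tg .A)⁻¹ * (tg .B)⁻¹) * g⁻¹ : SU2) : Matrix (Fin 2) (Fin 2) ℂ)
          = Matrix.trace ((ρ.hom (tg .A * tg .B * (tg .A)⁻¹ * (tg .B)⁻¹) : SU2) : Matrix (Fin 2) (Fin 2) ℂ) := by
        have e : (((g⁻¹ : SU2) : Matrix (Fin 2) (Fin 2) ℂ)) * (g : Matrix (Fin 2) (Fin 2) ℂ) = 1 := by
          rw [← Submonoid.coe_mul, inv_mul_cancel]; rfl
        rw [Submonoid.coe_mul, Submonoid.coe_mul, Matrix.trace_mul_comm, ← Matrix.mul_assoc, e,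
          Matrix.one_mul]
      show _ = (1 / 2 : ℝ) * (Matrix.trace
        ((ρ'.hom (tg .A * tg .B * (tg .A)⁻¹ * (tg .B)⁻¹) : SU2) : Matrix (Fin 2) (Fin 2) ℂ)).re
      rw [hg, h])

/-- The piece `P₄ = μ⁻¹([-1, 1))` of `R(T², 2)`. -/
def P4 : Set RT22 := mu ⁻¹' Set.Ico (-1) 1

/-- The piece `P₃ = μ⁻¹(1)` of `R(T², 2)`. -/
def P3 : Set RT22 := mu ⁻¹' {1}

/-- `x` has a representative with `A = r cos α + i σ_x √(1 - r²) + i σ_z r sin α` and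
`B = cos β + i σ_z sin β`, where `α ∈ [0, 2π]`, `β ∈ (0, π)`, `r ∈ [0, 1)`, for which
`a = i â · σ` and `b = i b̂ · σ`. -/
def HasP4Coords (x : RT22) (ahat bhat : Fin 3 → ℝ) : Prop :=
  ∃ ρ : TorusRep, ρ.cls = x ∧
    ∃ r ∈ Set.Ico (0 : ℝ) 1, ∃ α ∈ Set.Icc (0 : ℝ) (2 * Real.pi), ∃ β ∈ Set.Ioo (0 : ℝ) Real.pi,
      (ρ.hom (tg .A)).1 = quat (r * Real.cos α) ![Real.sqrt (1 - r ^ 2), 0, r * Real.sin α] ∧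
      (ρ.hom (tg .B)).1 = quat (Real.cos β) ![0, 0, Real.sin β] ∧
      (ρ.hom (tg .a)).1 = quat 0 ahat ∧
      (ρ.hom (tg .b)).1 = quat 0 bhat

/-- `x` is the point with coordinates `(α, β, γ)`: it has a representative with
`A = cos α + i σ_z sin α`, `B = cos β + i σ_z sin β`, `a = i σ_x cos γ + i σ_z sin γ`,
`b = a⁻¹`. -/
def HasP3Coords (x : RT22) (α β γ : ℝ) : Prop :=
  ∃ ρ : TorusRep, ρ.cls = x ∧
    (ρ.hom (tg .A)).1 = quat (Real.cos α) ![0, 0, Real.sin α] ∧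
    (ρ.hom (tg .B)).1 = quat (Real.cos β) ![0, 0, Real.sin β] ∧
    (ρ.hom (tg .a)).1 = quat 0 ![Real.cos γ, 0, Real.sin γ] ∧
    ρ.hom (tg .b) = (ρ.hom (tg .a))⁻¹

/-- The pillowcase `P₃ ∩ {γ = 0}` in `R(T², 2)`. -/
def pillowcase : Set RT22 := {x | x ∈ P3 ∧ ∃ α β : ℝ, HasP3Coords x α β 0}

/-! ### The solid torus with the arc `A₁`, loop `H`, arc `W` and perturbation loop `P` -/

/-- The generators of `π₁(S¹ × D² - A₁ ∪ H ∪ W ∪ P)`: the boundary loops `A`, `B`, loops `a`, `b`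
around the arc `A₁` near its two ends, a loop `h` around `H` and a loop `w` around `W`. -/
inductive TangleGen : Type
  | A | B | a | b | h | w

/-- The free generators of the tangle group. -/
def fg (x : TangleGen) : FreeGroup TangleGen := FreeGroup.of x

/-- The relators of `⟨A, B, a, b, h, w ∣ h w a B = a B h, b = h a⁻¹ w⁻¹ h⁻¹⟩`. -/
def tangleRels : Set (FreeGroup TangleGen) :=
  {(fg .h * fg .w * fg .a * fg .B) * (fg .a * fg .B * fg .h)⁻¹,
    fg .b * (fg .h * (fg .a)⁻¹ * (fg .w)⁻¹ * (fg .h)⁻¹)⁻¹}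

/-- The group `⟨A, B, a, b, h, w ∣ h w a B = a B h, b = h a⁻¹ w⁻¹ h⁻¹⟩` used to present
`π₁(S¹ × D² - A₁ ∪ H ∪ W ∪ P)`. The peripheral relation of the loop `P`, that `h⁻¹ A` and `B`
commute, is not listed: every representation considered below satisfies it because of the holonomy
condition (`lambdaP_comm_muP`). -/
abbrev TangleGroup : Type := PresentedGroup tangleRels

/-- The class of a generator. -/
def pg (x : TangleGen) : TangleGroup := PresentedGroup.of x

/-- The longitude `λ_P = h⁻¹ A` of the perturbation loop. -/
def lambdaP : TangleGroup := (pg .h)⁻¹ * pg .A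

/-- The meridian `μ_P = B` of the perturbation loop. -/
def muP : TangleGroup := pg .B

/-- The holonomy condition: whenever `ρ(λ_P) = cos φ + i (r · σ) sin φ` for an angle `φ` and a unit
vector `r`, then `ρ(μ_P) = cos ν + i (r · σ) sin ν`, with `ν = ε sin φ`. -/
def HolonomyCond (ε : ℝ) (ρ : TangleGroup →* SU2) : Prop :=
  ∀ (φ : ℝ) (r : Fin 3 → ℝ), IsUnitVec r →
    (ρ lambdaP).1 = quat (Real.cos φ) (Real.sin φ • r) →
      (ρ muP).1 = quat (Real.cos (ε * Real.sin φ)) (Real.sin (ε * Real.sin φ) • r)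

/-- Loops around `A₁` and `H` go to traceless matrices, loops around `W` go to `-1`, and the
holonomy condition holds. -/
def PerturbedCond (ε : ℝ) (ρ : TangleGroup →* SU2) : Prop :=
  IsTraceless (ρ (pg .a)) ∧ IsTraceless (ρ (pg .b)) ∧ IsTraceless (ρ (pg .h)) ∧
    (ρ (pg .w)).1 = -1 ∧ HolonomyCond ε ρ

/-- Representations defining the perturbed character variety. -/
abbrev PerturbedRep (ε : ℝ) : Type := Rep TangleGroup (PerturbedCond ε)

/-- The perturbed character variety `R_π^♮(S¹ × D², A₁)`. -/
abbrev RPert (ε : ℝ) : Type := CharVar TangleGroup (PerturbedCond ε)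

/-! ### The pullback map to `R(T², 2)` -/

theorem su2_entries (U : SU2) :
    U.1 1 1 = (starRingEnd ℂ) (U.1 0 0) ∧ U.1 1 0 = -(starRingEnd ℂ) (U.1 0 1) := by
  have h1 : U.1 * star U.1 = 1 :=
    (Matrix.mem_unitaryGroup_iff).1 (Matrix.mem_specialUnitaryGroup_iff.1 U.2).1
  have h2 : U.1.det = 1 := (Matrix.mem_specialUnitaryGroup_iff.1 U.2).2
  have h3 : star U.1 = U.1.adjugate := by
    calc star U.1 = (U.1.adjugate * U.1) * star U.1 := by
          rw [Matrix.adjugate_mul, h2, one_smul, Matrix.one_mul]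
      _ = U.1.adjugate := by rw [Matrix.mul_assoc, h1, Matrix.mul_one]
  have e00 := congrFun (congrFun h3 0) 0
  have e10 := congrFun (congrFun h3 1) 0
  simp [Matrix.adjugate_fin_two, Matrix.star_apply] at e00 e10
  exact ⟨e00.symm, by rw [e10]; simp⟩

theorem su2_norm (U : SU2) :
    (U.1 0 0).re ^ 2 + (U.1 0 0).im ^ 2 + (U.1 0 1).re ^ 2 + (U.1 0 1).im ^ 2 = 1 := by
  have h2 : U.1.det = 1 := (Matrix.mem_specialUnitaryGroup_iff.1 U.2).2
  rw [Matrix.det_fin_two, (su2_entries U).1, (su2_entries U).2] at h2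
  have := congrArg Complex.re h2
  simp at this
  nlinarith [this]

theorem su2_eq_quat (U : SU2) :
    U.1 = quat (U.1 0 0).re ![(U.1 0 1).im, (U.1 0 1).re, (U.1 0 0).im] := by
  obtain ⟨h1, h2⟩ := su2_entries U
  ext i j
  fin_cases i <;> fin_cases j <;>
    simp [quat, sigmaX, sigmaY, sigmaZ, h1, h2, Complex.ext_iff]

/-- Every element of `SU(2)` has the form `cos φ + i (r · σ) sin φ`. -/
theorem su2_polar (U : SU2) :
    ∃ (φ : ℝ) (r : Fin 3 → ℝ), IsUnitVec r ∧ U.1 = quat (Real.cos φ) (Real.sin φ • r) := by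
  have hn := su2_norm U
  have hq := su2_eq_quat U
  set t := (U.1 0 0).re
  set z := (U.1 0 0).im
  set y := (U.1 0 1).re
  set x := (U.1 0 1).im
  have hc : Real.cos (Real.arccos t) = t :=
    Real.cos_arccos (by nlinarith [sq_nonneg x, sq_nonneg y, sq_nonneg z])
      (by nlinarith [sq_nonneg x, sq_nonneg y, sq_nonneg z])
  set s := Real.sin (Real.arccos t) with hs
  have hs2 : s ^ 2 = x ^ 2 + y ^ 2 + z ^ 2 := by
    have := Real.sin_sq_add_cos_sq (Real.arccos t)
    rw [hc, ← hs] at this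
    linarith
  by_cases h0 : s = 0
  · have hx : x = 0 := by
      have : x ^ 2 = 0 := by nlinarith [sq_nonneg x, sq_nonneg y, sq_nonneg z]
      exact pow_eq_zero_iff (two_ne_zero) |>.1 this
    have hy : y = 0 := by
      have : y ^ 2 = 0 := by nlinarith [sq_nonneg x, sq_nonneg y, sq_nonneg z]
      exact pow_eq_zero_iff (two_ne_zero) |>.1 this
    have hz : z = 0 := by
      have : z ^ 2 = 0 := by nlinarith [sq_nonneg x, sq_nonneg y, sq_nonneg z]
      exact pow_eq_zero_iff (two_ne_zero) |>.1 this
    refine ⟨Real.arccos t, ![1, 0, 0], by simp [IsUnitVec], ?_⟩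
    rw [hc, ← hs, h0, hq, hx, hy, hz]
    simp [quat]
  · refine ⟨Real.arccos t, ![x / s, y / s, z / s], ?_, ?_⟩
    · simp only [IsUnitVec, Matrix.cons_val_zero, Matrix.cons_val_one, Matrix.cons_val]
      field_simp
      linarith
    · rw [hc, ← hs, hq]
      have : s • ![x / s, y / s, z / s] = ![x, y, z] := by
        ext i
        fin_cases i <;> simp <;> field_simp
      rw [this]

theorem quat_comm (t t' s s' : ℝ) (r : Fin 3 → ℝ) :
    quat t (s • r) * quat t' (s' • r) = quat t' (s' • r) * quat t (s • r) := by
  ext i j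
  fin_cases i <;> fin_cases j <;>
    simp [quat, sigmaX, sigmaY, sigmaZ, Matrix.mul_apply, Fin.sum_univ_two] <;> ring

/-- Under the holonomy condition `ρ(λ_P)` and `ρ(μ_P)` commute. -/
theorem lambdaP_comm_muP {ε : ℝ} {ρ : TangleGroup →* SU2} (hρ : HolonomyCond ε ρ) :
    ρ lambdaP * ρ muP = ρ muP * ρ lambdaP := by
  obtain ⟨φ, r, hr, h⟩ := su2_polar (ρ lambdaP)
  have h' := hρ φ r hr h
  apply Subtype.ext
  rw [Submonoid.coe_mul, Submonoid.coe_mul, h, h', quat_comm]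

theorem su2_traceless_sq {U : SU2} (hU : IsTraceless U) : (U * U).1 = -1 := by
  obtain ⟨h1, h2⟩ := su2_entries U
  have hn := su2_norm U
  have ht : U.1 0 0 + U.1 1 1 = 0 := by simpa [IsTraceless, Matrix.trace_fin_two] using hU
  have hre : (U.1 0 0).re = 0 := by
    rw [h1] at ht
    have := congrArg Complex.re ht
    simp at this
    linarith
  rw [Submonoid.coe_mul]
  ext i j
  fin_cases i <;> fin_cases j <;>
    simp [Matrix.mul_apply, Fin.sum_univ_two, h1, h2, Complex.ext_iff, hre] <;>
    (try constructor) <;> nlinarith [hn, hre]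

/-- The values of `ρ` on the four boundary loops `A`, `B`, `a`, `b`. -/
def boundaryValue (ρ : TangleGroup →* SU2) : TorusGen → SU2
  | .A => ρ (pg .A)
  | .B => ρ (pg .B)
  | .a => ρ (pg .a)
  | .b => ρ (pg .b)

theorem boundaryValue_rel {ε : ℝ} (ρ : PerturbedRep ε) :
    ∀ r ∈ torusRels, FreeGroup.lift (boundaryValue ρ.hom) r = 1 := by
  obtain ⟨ρ, ha, hb, -, hw, hol⟩ := ρ
  intro r hr
  rw [torusRels, Set.mem_singleton_iff] at hr
  subst hr
  have hrel1 : pg .h * pg .w * pg .a * pg .B = pg .a * pg .B * pg .h := by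
    rw [← mul_inv_eq_one]
    exact PresentedGroup.one_of_mem (rels := tangleRels) (Or.inl rfl)
  have hrel2 : pg .b = pg .h * (pg .a)⁻¹ * (pg .w)⁻¹ * (pg .h)⁻¹ := by
    rw [← mul_inv_eq_one]
    exact PresentedGroup.one_of_mem (rels := tangleRels) (Or.inr rfl)
  have hc := lambdaP_comm_muP hol
  have e1 := congrArg ρ hrel1
  have e2 := congrArg ρ hrel2
  simp only [lambdaP, muP, map_mul, map_inv] at hc e1 e2
  simp only [map_mul, map_inv, FreeGroup.lift_apply_of, boundaryValue]
  have haa : ρ (pg .a) * ρ (pg .a) = ρ (pg .w) :=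
    Subtype.ext ((su2_traceless_sq ha).trans hw.symm)
  have hbb : ρ (pg .b) * ρ (pg .b) = ρ (pg .w) :=
    Subtype.ext ((su2_traceless_sq hb).trans hw.symm)
  have hww : ρ (pg .w) * ρ (pg .w) = 1 := by
    apply Subtype.ext
    rw [Submonoid.coe_mul, hw]
    simp
  have hwc : ∀ g : SU2, ρ (pg .w) * g = g * ρ (pg .w) := by
    intro g
    apply Subtype.ext
    rw [Submonoid.coe_mul, Submonoid.coe_mul, hw]
    simp
  generalize ρ (pg .A) = A at *
  generalize ρ (pg .B) = B at *
  generalize ρ (pg .a) = a at *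
  generalize ρ (pg .b) = b at *
  generalize ρ (pg .h) = h at *
  generalize ρ (pg .w) = w at *
  have k1 : A * B * A⁻¹ = h * B * h⁻¹ := by
    have : A * B = h * B * (h⁻¹ * A) := by
      calc A * B = h * (h⁻¹ * A * B) := by group
        _ = h * (B * (h⁻¹ * A)) := by rw [hc]
        _ = _ := by group
    rw [this]; group
  have k2 : h * B * h⁻¹ * B⁻¹ = b * a := by
    have : B * h * B⁻¹ = a⁻¹ * h * w * a := by
      calc B * h * B⁻¹ = a⁻¹ * (a * B * h) * B⁻¹ := by group
        _ = a⁻¹ * (h * w * a * B) * B⁻¹ := by rw [e1]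
        _ = _ := by group
    calc h * B * h⁻¹ * B⁻¹ = h * (B * h * B⁻¹)⁻¹ := by group
      _ = h * (a⁻¹ * h * w * a)⁻¹ := by rw [this]
      _ = h * a⁻¹ * w⁻¹ * h⁻¹ * a := by group
      _ = b * a := by rw [← e2]
  rw [k1, k2]
  calc b * a * a * b = b * (a * a) * b := by group
    _ = w * (b * b) := by rw [haa, ← hwc b]; group
    _ = 1 := by rw [hbb, hww]

/-- The pullback of a representation to the twice-punctured torus: the representation of
`π₁(T² - {p₁, p₂})` with the same values on `A`, `B`, `a`, `b`. -/
def restrictRep {ε : ℝ} (ρ : PerturbedRep ε) : TorusRep :=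
  ⟨PresentedGroup.toGroup (boundaryValue_rel ρ), by
    refine ⟨?_, ?_⟩
    · rw [tg, PresentedGroup.toGroup.of]; exact ρ.cond.1
    · rw [tg, PresentedGroup.toGroup.of]; exact ρ.cond.2.1⟩

/-- The map `R_π^♮(S¹ × D², A₁) → R(T², 2)`. -/
def restrict (ε : ℝ) : RPert ε → RT22 :=
  Quotient.map' (s₁ := Rep.conjSetoid _ _) (s₂ := Rep.conjSetoid _ _) restrictRep (by
    rintro ρ ρ' ⟨g, hg⟩
    refine ⟨g, fun x => ?_⟩
    have : (restrictRep ρ').hom = (MulAut.conj g).toMonoidHom.comp (restrictRep ρ).hom := by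
      apply PresentedGroup.ext
      intro t
      have e1 : (restrictRep ρ').hom (PresentedGroup.of t) = boundaryValue ρ'.hom t :=
        PresentedGroup.toGroup.of (boundaryValue_rel ρ')
      have e2 : (restrictRep ρ).hom (PresentedGroup.of t) = boundaryValue ρ.hom t :=
        PresentedGroup.toGroup.of (boundaryValue_rel ρ)
      rw [MonoidHom.comp_apply, e1, e2]
      cases t <;> exact hg _
    rw [this]
    rfl)

/-- The sphere Lagrangian `L_s`: the image of `R_π^♮(S¹ × D², A₁)` in `R(T², 2)`. -/
def sphereLagrangian (ε : ℝ) : Set RT22 := Set.range (restrict ε)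

/-! ### Spherical coordinates and the explicit parametrization -/

/-- The unit sphere `S²` in Euclidean `ℝ³`. -/
abbrev S2 : Type := Metric.sphere (0 : EuclideanSpace ℝ (Fin 3)) 1

/-- The point of `S²` with spherical-polar coordinates `(φ, θ)`, where `φ` is the polar angle. -/
noncomputable def sph (φ θ : ℝ) : S2 :=
  ⟨!₂[Real.sin φ * Real.cos θ, Real.sin φ * Real.sin θ, Real.cos φ], by
    rw [mem_sphere_zero_iff_norm, EuclideanSpace.norm_eq, Real.sqrt_eq_one]
    simp only [Fin.sum_univ_three, Real.norm_eq_abs, sq_abs]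
    simp
    nlinarith [Real.sin_sq_add_cos_sq φ, Real.sin_sq_add_cos_sq θ]⟩

/-- The north pole `φ = 0`. -/
noncomputable def northPole : S2 := sph 0 0

/-- The south pole `φ = π`. -/
noncomputable def southPole : S2 := sph Real.pi 0

/-- The quantity `cos² ν + sin² ν sin² θ`. -/
noncomputable def den (ν θ : ℝ) : ℝ := Real.cos ν ^ 2 + Real.sin ν ^ 2 * Real.sin θ ^ 2

/-- The class `x` is represented by the `ρ` given by the explicit matrices with parameters
`(φ, θ)`, where `ν = ε sin φ`. -/
def HasParam (ε : ℝ) (x : RPert ε) (φ θ ν : ℝ) : Prop :=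
  ∃ ρ : PerturbedRep ε, ρ.cls = x ∧
    (ρ.hom (pg .a)).1 = Complex.I • sigmaZ ∧
    (ρ.hom (pg .b)).1 = -((ρ.hom (pg .h)).1 * (ρ.hom (pg .a))⁻¹.1 * (ρ.hom (pg .h))⁻¹.1) ∧
    (ρ.hom (pg .b)).1 = quat 0 (-(den ν θ)⁻¹ •
      ![Real.sin (2 * ν) * Real.sin θ, 0,
        Real.cos ν ^ 2 - Real.sin ν ^ 2 * Real.sin θ ^ 2]) ∧
    (ρ.hom (pg .A)).1 = (ρ.hom (pg .h)).1 *
      quat (Real.cos φ) (Real.sin φ • ![Real.cos θ, Real.sin θ, 0]) ∧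
    (ρ.hom (pg .B)).1 = quat (Real.cos ν) (Real.sin ν • ![Real.cos θ, Real.sin θ, 0]) ∧
    (ρ.hom (pg .h)).1 = quat 0 ((Real.sqrt (den ν θ))⁻¹ •
      ![Real.cos ν, 0, -(Real.sin ν * Real.sin θ)]) ∧
    (ρ.hom (pg .w)).1 = -1

end PerturbedCharVar

open PerturbedCharVar

namespace PerturbedCharVar

/-! Identify `SU(2)` with the unit quaternions and put `l = h⁻¹A`. Since `cos` and `sinc` are even,
the holonomy condition says exactly that `B` has real part `cosHol` and vector part `sinHol` times
that of `l`, both factors being functions of the real part of `l`. A representation is therefore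
determined by `a`, `h`, `l`. With `w = -1`, the relation `h w a B = a B h` says that `h`
anticommutes with `aB`: `aB` is traceless and orthogonal to `h`.

These conditions prevent `h` from being `±a`, so conjugation brings `a` to `iσ_z` and `h` into the
`xz`-plane with positive `x`-component. Tracelessness of `aB` then removes the `σ_z`-component of
`l`, leaving a point of `S²`, and orthogonality fixes the direction of `h` (`exists_conj_standard`,
`exists_sphRep_cls_eq`). This gives a continuous bijection from `S²`. Three trace functions separate
classes (`injective_traceCoords_sphRep`), so the target is Hausdorff, and compactness of `S²` yields
the homeomorphism.

Restriction to the torus forgets `h`. The traces of `A`, `B`, `AB`, `ab`, `aA` still recover the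
point of the sphere unless `x = y = 0`, while the two poles are conjugate by `iσ_z`
(`eq_or_poles_of_restrict_eq`, `restrict_sphRep_eq_of_poles`). The coordinates on the image come
from expressing `A`, `B`, `a`, `b` in an orthonormal frame adapted to the normal form
(`exists_frame`); on `P₄` the normal form has trivial stabilizer up to sign, whence uniqueness of
`â`, `b̂`. The choice `ε₀ = 1/2` guarantees `0 < sinHol < 1/2 < cosHol`. -/

/-! ### Real coordinates on `SU(2)` -/

/-- The real part of `t + i (v · σ)`. -/
def qre (U : SU2) : ℝ := (U.1 0 0).re

/-- The coefficient of `i σ_x`. -/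
def qx (U : SU2) : ℝ := (U.1 0 1).im

/-- The coefficient of `i σ_y`. -/
def qy (U : SU2) : ℝ := (U.1 0 1).re

/-- The coefficient of `i σ_z`. -/
def qz (U : SU2) : ℝ := (U.1 0 0).im

theorem coe_eq_quat_coords (U : SU2) : U.1 = quat (qre U) ![qx U, qy U, qz U] := su2_eq_quat U

theorem coords_norm (U : SU2) : qre U ^ 2 + qx U ^ 2 + qy U ^ 2 + qz U ^ 2 = 1 := by
  have := su2_norm U
  simp only [qre, qx, qy, qz]
  linarith

theorem su2_ext {U V : SU2} (h0 : qre U = qre V) (h1 : qx U = qx V) (h2 : qy U = qy V)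
    (h3 : qz U = qz V) : U = V := by
  apply Subtype.ext
  rw [coe_eq_quat_coords U, coe_eq_quat_coords V, h0, h1, h2, h3]

theorem coe_eq_quat_iff (U : SU2) (t : ℝ) (v : Fin 3 → ℝ) :
    U.1 = quat t v ↔ qre U = t ∧ qx U = v 0 ∧ qy U = v 1 ∧ qz U = v 2 := by
  constructor
  · intro h
    simp [qre, qx, qy, qz, h, quat, sigmaX, sigmaY, sigmaZ]
  · rintro ⟨h0, h1, h2, h3⟩
    rw [coe_eq_quat_coords U, h0, h1, h2, h3]
    congr 1
    ext i
    fin_cases i <;> rfl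

theorem qre_mul (U V : SU2) :
    qre (U * V) = qre U * qre V - (qx U * qx V + qy U * qy V + qz U * qz V) := by
  simp [qre, qx, qy, qz, Matrix.mul_apply, Fin.sum_univ_two, (su2_entries V).2]
  ring

theorem qx_mul (U V : SU2) :
    qx (U * V) = qre U * qx V + qre V * qx U - (qy U * qz V - qz U * qy V) := by
  simp [qre, qx, qy, qz, Matrix.mul_apply, Fin.sum_univ_two, (su2_entries V).1]
  ring

theorem qy_mul (U V : SU2) :
    qy (U * V) = qre U * qy V + qre V * qy U - (qz U * qx V - qx U * qz V) := by
  simp [qre, qx, qy, qz, Matrix.mul_apply, Fin.sum_univ_two, (su2_entries V).1]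
  ring

theorem qz_mul (U V : SU2) :
    qz (U * V) = qre U * qz V + qre V * qz U - (qx U * qy V - qy U * qx V) := by
  simp [qre, qx, qy, qz, Matrix.mul_apply, Fin.sum_univ_two, (su2_entries V).2]
  ring

theorem coe_inv_eq_star (U : SU2) : (U⁻¹).1 = star U.1 := rfl

theorem qre_inv (U : SU2) : qre U⁻¹ = qre U := by
  simp [qre, coe_inv_eq_star, Matrix.star_apply]

theorem qx_inv (U : SU2) : qx U⁻¹ = -qx U := by
  simp [qx, coe_inv_eq_star, Matrix.star_apply, (su2_entries U).2]

theorem qy_inv (U : SU2) : qy U⁻¹ = -qy U := by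
  simp [qy, coe_inv_eq_star, Matrix.star_apply, (su2_entries U).2]

theorem qz_inv (U : SU2) : qz U⁻¹ = -qz U := by
  simp [qz, coe_inv_eq_star, Matrix.star_apply]

theorem trace_eq_two_mul_qre (U : SU2) : Matrix.trace U.1 = ((2 * qre U : ℝ) : ℂ) := by
  simp [Matrix.trace_fin_two, (su2_entries U).1, qre, Complex.ext_iff]
  ring

theorem isTraceless_iff (U : SU2) : IsTraceless U ↔ qre U = 0 := by
  rw [IsTraceless, trace_eq_two_mul_qre]
  norm_cast
  simp

theorem coe_eq_neg_one_iff (U : SU2) :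
    U.1 = -1 ↔ qre U = -1 ∧ qx U = 0 ∧ qy U = 0 ∧ qz U = 0 := by
  have : (-1 : Matrix (Fin 2) (Fin 2) ℂ) = quat (-1) 0 := by
    simp [quat]
  rw [this, coe_eq_quat_iff]
  rfl

theorem qre_mul_comm (U V : SU2) : qre (U * V) = qre (V * U) := by
  rw [qre_mul, qre_mul]; ring

theorem qre_conj (g U : SU2) : qre (g * U * g⁻¹) = qre U := by
  rw [qre_mul_comm, ← mul_assoc, inv_mul_cancel, one_mul]

/-- The element of `SU(2)` with given coordinates. -/
noncomputable def mkSU2 (t x y z : ℝ) (h : t ^ 2 + x ^ 2 + y ^ 2 + z ^ 2 = 1) : SU2 :=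
  ⟨quat t ![x, y, z], by
    rw [Matrix.mem_specialUnitaryGroup_iff, Matrix.mem_unitaryGroup_iff]
    constructor
    · ext i j
      fin_cases i <;> fin_cases j <;>
        simp [quat, sigmaX, sigmaY, sigmaZ, Matrix.mul_apply, Fin.sum_univ_two,
          Matrix.star_apply, Complex.ext_iff] <;>
        constructor <;> linarith
    · simp [quat, sigmaX, sigmaY, sigmaZ, Matrix.det_fin_two, Complex.ext_iff]
      constructor <;> linarith⟩

section mk
variable (t x y z : ℝ) (h : t ^ 2 + x ^ 2 + y ^ 2 + z ^ 2 = 1)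

theorem qre_mk : qre (mkSU2 t x y z h) = t :=
  ((coe_eq_quat_iff (mkSU2 t x y z h) t ![x, y, z]).1 rfl).1
theorem qx_mk : qx (mkSU2 t x y z h) = x :=
  ((coe_eq_quat_iff (mkSU2 t x y z h) t ![x, y, z]).1 rfl).2.1
theorem qy_mk : qy (mkSU2 t x y z h) = y :=
  ((coe_eq_quat_iff (mkSU2 t x y z h) t ![x, y, z]).1 rfl).2.2.1
theorem qz_mk : qz (mkSU2 t x y z h) = z :=
  ((coe_eq_quat_iff (mkSU2 t x y z h) t ![x, y, z]).1 rfl).2.2.2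

end mk

theorem continuous_qre : Continuous qre :=
  Complex.continuous_re.comp (continuous_subtype_val.matrix_elem 0 0)

theorem continuous_mkSU2 {X : Type*} [TopologicalSpace X] {t x y z : X → ℝ}
    (h : ∀ p, t p ^ 2 + x p ^ 2 + y p ^ 2 + z p ^ 2 = 1) (ht : Continuous t)
    (hx : Continuous x) (hy : Continuous y) (hz : Continuous z) :
    Continuous fun p => mkSU2 (t p) (x p) (y p) (z p) (h p) := by
  apply Continuous.subtype_mk
  refine continuous_matrix fun i j => ?_
  fin_cases i <;> fin_cases j <;> simp [quat, sigmaX, sigmaY, sigmaZ] <;> fun_prop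

theorem continuous_inv_su2 : Continuous fun U : SU2 => U⁻¹ :=
  Continuous.subtype_mk (continuous_subtype_val.star) _

/-! ### Moving an orthonormal pair to the coordinate axes -/

/-- Orthogonal imaginary quaternions anticommute, and the inverse of an imaginary unit is its
negative. -/
theorem mul_eq_inv_mul_of_orthogonal {u n : SU2} (hu : qre u = 0) (hn : qre n = 0)
    (hun : qre (u * n) = 0) : u * n = n⁻¹ * u := by
  rw [qre_mul, hu, hn] at hun
  apply su2_ext <;>
    simp only [qre_mul, qx_mul, qy_mul, qz_mul, qre_inv, qx_inv, qy_inv, qz_inv, hu, hn] <;>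
    linarith

/-- Two traceless matrices `u`, `v` are conjugate by an element inverting a given common
normal `n` of `u`, `v`. -/
theorem exists_conj_traceless {u v n : SU2} (hu : qre u = 0) (hv : qre v = 0) (hn : qre n = 0)
    (hun : qre (u * n) = 0) (hvn : qre (v * n) = 0) :
    ∃ g : SU2, g * u * g⁻¹ = v ∧ g * n * g⁻¹ = n⁻¹ := by
  suffices ∃ g : SU2, g * u = v * g ∧ g * n = n⁻¹ * g by
    obtain ⟨g, h1, h2⟩ := this
    exact ⟨g, by rw [h1]; group, by rw [h2]; group⟩
  set p := (qx u + qx v) ^ 2 + (qy u + qy v) ^ 2 + (qz u + qz v) ^ 2 with hp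
  rcases (show 0 ≤ p by positivity).eq_or_lt with h0 | h0
  · have hx : qx v = -qx u := by
      nlinarith [sq_nonneg (qx u + qx v), sq_nonneg (qy u + qy v), sq_nonneg (qz u + qz v)]
    have hy : qy v = -qy u := by
      nlinarith [sq_nonneg (qx u + qx v), sq_nonneg (qy u + qy v), sq_nonneg (qz u + qz v)]
    have hz : qz v = -qz u := by
      nlinarith [sq_nonneg (qx u + qx v), sq_nonneg (qy u + qy v), sq_nonneg (qz u + qz v)]
    have hvu : v = u⁻¹ := su2_ext (by rw [qre_inv, hu, hv]) (by rw [qx_inv, hx])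
      (by rw [qy_inv, hy]) (by rw [qz_inv, hz])
    have h1 := mul_eq_inv_mul_of_orthogonal hu hn hun
    have h2 := mul_eq_inv_mul_of_orthogonal hn hu (by rw [qre_mul_comm, hun])
    -- When `v = -u` there is no bisector; the half-turn about the third axis `u * n` reverses both
    -- `u` and `n`.
    refine ⟨u * n, ?_, ?_⟩
    · rw [hvu, mul_assoc, h2]; group
    · rw [h1]
      calc n⁻¹ * u * n = n⁻¹ * (u * n) := by group
        _ = _ := by rw [h1]
  · have Nu := coords_norm u
    have Nv := coords_norm v
    have hs : (Real.sqrt p)⁻¹ ^ 2 * p = 1 := by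
      rw [inv_pow, Real.sq_sqrt h0.le, inv_mul_cancel₀ h0.ne']
    set c := (Real.sqrt p)⁻¹
    -- The half-turn about the bisector of `u` and `v` exchanges them and reverses anything
    -- orthogonal to both.
    refine ⟨mkSU2 0 (c * (qx u + qx v)) (c * (qy u + qy v)) (c * (qz u + qz v))
      (by rw [← hs, hp]; ring), ?_, mul_eq_inv_mul_of_orthogonal (qre_mk _ _ _ _ _) hn ?_⟩
    · rw [hu] at Nu
      rw [hv] at Nv
      apply su2_ext <;>
        simp only [qre_mul, qx_mul, qy_mul, qz_mul, qre_mk, qx_mk, qy_mk, qz_mk, hu, hv]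
      · linear_combination c * (Nv - Nu)
      all_goals ring
    · rw [qre_mul, hu, hn] at hun
      rw [qre_mul, hv, hn] at hvn
      simp only [qre_mul, qre_mk, qx_mk, qy_mk, qz_mk, hn]
      linear_combination c * hun + c * hvn

/-- The matrix `i σ_x`. -/
noncomputable def unitX : SU2 := mkSU2 0 1 0 0 (by norm_num)

/-- The matrix `i σ_z`. -/
noncomputable def unitZ : SU2 := mkSU2 0 0 0 1 (by norm_num)

theorem exists_common_normal_unitZ (u : SU2) (hu : qre u = 0) :
    ∃ n : SU2, qre n = 0 ∧ qre (u * n) = 0 ∧ qre (unitZ * n) = 0 := by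
  by_cases h : qx u = 0
  · refine ⟨unitX, ?_, ?_, ?_⟩ <;>
      simp [unitX, unitZ, qre_mul, qre_mk, qx_mk, qy_mk, qz_mk, h]
  · have h0 : 0 < qx u ^ 2 + qy u ^ 2 := by positivity
    have hs : (Real.sqrt (qx u ^ 2 + qy u ^ 2))⁻¹ ^ 2 * (qx u ^ 2 + qy u ^ 2) = 1 := by
      rw [inv_pow, Real.sq_sqrt h0.le, inv_mul_cancel₀ h0.ne']
    set c := (Real.sqrt (qx u ^ 2 + qy u ^ 2))⁻¹
    refine ⟨mkSU2 0 (-(c * qy u)) (c * qx u) 0 (by rw [← hs]; ring), ?_, ?_, ?_⟩ <;>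
      simp [unitZ, qre_mul, qre_mk, qx_mk, qy_mk, qz_mk, hu]
    ring

/-- Two half-turns suffice: one takes `e₃` to `-iσ_z`, the next takes the image of `e₁` to `iσ_x`
while reversing the `z`-axis. Aiming at the wrong sign first makes the reversal restore the right
one. -/
theorem exists_conj_axes {e₁ e₃ : SU2} (h1 : qre e₁ = 0) (h3 : qre e₃ = 0)
    (h13 : qre (e₁ * e₃) = 0) :
    ∃ g : SU2, g * e₁ * g⁻¹ = unitX ∧ g * e₃ * g⁻¹ = unitZ := by
  have hZ : qre unitZ = 0 := qre_mk _ _ _ _ _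
  have hX : qre unitX = 0 := qre_mk _ _ _ _ _
  obtain ⟨n, hn, hun, hvn⟩ := exists_common_normal_unitZ e₃ h3
  obtain ⟨g, hg, -⟩ := exists_conj_traceless (v := unitZ⁻¹) h3 (by rw [qre_inv, hZ]) hn hun
    (by
      rw [qre_mul] at hvn ⊢
      rw [qre_inv, qx_inv, qy_inv, qz_inv]
      rw [hZ] at hvn ⊢
      linarith)
  have hu : qre (g * e₁ * g⁻¹ * unitZ) = 0 := by
    have e : g * e₁ * g⁻¹ * unitZ = g * (e₁ * e₃⁻¹) * g⁻¹ := by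
      rw [← inv_inv unitZ, ← hg]; group
    rw [e, qre_conj]
    rw [qre_mul] at h13 ⊢
    rw [qre_inv, qx_inv, qy_inv, qz_inv]
    rw [h3] at h13 ⊢
    linarith
  obtain ⟨k, hk1, hk2⟩ := exists_conj_traceless (u := g * e₁ * g⁻¹) (v := unitX) (n := unitZ)
    (by rw [qre_conj, h1]) hX hZ hu
    (by simp [unitX, unitZ, qre_mul, qre_mk, qx_mk, qy_mk, qz_mk])
  refine ⟨k * g, by rw [← hk1]; group, ?_⟩
  calc k * g * e₃ * (k * g)⁻¹ = k * (g * e₃ * g⁻¹) * k⁻¹ := by group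
    _ = (k * unitZ * k⁻¹)⁻¹ := by rw [hg]; group
    _ = unitZ := by rw [hk2, inv_inv]

/-- An orthonormal pair of traceless matrices can be conjugated to `i σ_x`, `i σ_z`, and the new
coordinates are the components in the orthonormal frame. -/
theorem exists_frame {e₁ e₃ : SU2} (h1 : qre e₁ = 0) (h3 : qre e₃ = 0)
    (h13 : qre (e₁ * e₃) = 0) :
    ∃ g : SU2, ∀ U : SU2, qre (g * U * g⁻¹) = qre U ∧ qx (g * U * g⁻¹) = -qre (e₁ * U) ∧
      qy (g * U * g⁻¹) = -qre (e₁ * e₃ * U) ∧ qz (g * U * g⁻¹) = -qre (e₃ * U) := by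
  obtain ⟨g, hg1, hg3⟩ := exists_conj_axes h1 h3 h13
  refine ⟨g, fun U => ⟨qre_conj g U, ?_, ?_, ?_⟩⟩
  · have : g * (e₁ * U) * g⁻¹ = unitX * (g * U * g⁻¹) := by rw [← hg1]; group
    rw [← qre_conj g (e₁ * U), this, qre_mul]
    simp [unitX, qre_mk, qx_mk, qy_mk, qz_mk]
  · have : g * (e₁ * e₃ * U) * g⁻¹ = unitX * unitZ * (g * U * g⁻¹) := by
      rw [← hg1, ← hg3]; group
    rw [← qre_conj g (e₁ * e₃ * U), this]
    simp [qre_mul, qx_mul, qy_mul, qz_mul, unitX, unitZ, qre_mk, qx_mk, qy_mk, qz_mk]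
  · have : g * (e₃ * U) * g⁻¹ = unitZ * (g * U * g⁻¹) := by rw [← hg3]; group
    rw [← qre_conj g (e₃ * U), this, qre_mul]
    simp [unitZ, qre_mk, qx_mk, qy_mk, qz_mk]

/-! ### Trace functions on character varieties -/

theorem Rep.cls_eq_iff {G : Type} [Group G] {C : (G →* SU2) → Prop} {ρ ρ' : Rep G C} :
    ρ.cls = ρ'.cls ↔ ∃ g : SU2, ∀ x : G, ρ'.hom x = g * ρ.hom x * g⁻¹ :=
  Quotient.eq (r := Rep.conjSetoid G C)

theorem CharVar.exists_rep {G : Type} [Group G] {C : (G →* SU2) → Prop} (x : CharVar G C) :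
    ∃ ρ : Rep G C, ρ.cls = x :=
  Quotient.exists_rep (s := Rep.conjSetoid G C) x

theorem Rep.qre_eq_of_cls_eq {G : Type} [Group G] {C : (G →* SU2) → Prop} {ρ ρ' : Rep G C}
    (h : ρ.cls = ρ'.cls) (x : G) : qre (ρ.hom x) = qre (ρ'.hom x) := by
  obtain ⟨g, hg⟩ := Rep.cls_eq_iff.1 h
  rw [hg, qre_conj]

/-- Half the trace of the value on a fixed group element. -/
def CharVar.traceFun {G : Type} [Group G] {C : (G →* SU2) → Prop} (g : G) : CharVar G C → ℝ :=
  Quotient.lift (s := Rep.conjSetoid G C) (fun ρ => qre (ρ.hom g))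
    (fun _ _ h => Rep.qre_eq_of_cls_eq (Quotient.sound h) g)

theorem CharVar.traceFun_cls {G : Type} [Group G] {C : (G →* SU2) → Prop} (g : G)
    (ρ : Rep G C) : CharVar.traceFun g ρ.cls = qre (ρ.hom g) := rfl

theorem Rep.continuous_apply {G : Type} [Group G] {C : (G →* SU2) → Prop} (g : G) :
    Continuous fun ρ : Rep G C => ρ.hom g :=
  (_root_.continuous_apply g).comp continuous_induced_dom

theorem CharVar.continuous_traceFun {G : Type} [Group G] {C : (G →* SU2) → Prop} (g : G) :
    Continuous (CharVar.traceFun g : CharVar G C → ℝ) :=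
  Continuous.quotient_lift (continuous_qre.comp (Rep.continuous_apply g)) _

theorem Rep.continuous_cls {G : Type} [Group G] {C : (G →* SU2) → Prop} :
    Continuous (Rep.cls : Rep G C → CharVar G C) :=
  continuous_quotient_mk'

theorem mu_cls (ρ : TorusRep) :
    mu ρ.cls = qre (ρ.hom (tg .A * tg .B * (tg .A)⁻¹ * (tg .B)⁻¹)) := by
  show (1 / 2 : ℝ) * (Matrix.trace (ρ.hom (tg .A * tg .B * (tg .A)⁻¹ * (tg .B)⁻¹)).1).re = _
  rw [trace_eq_two_mul_qre, Complex.ofReal_re]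
  ring

/-- A family of representations is continuous if its values on generators are. -/
theorem continuous_rep_of_generators {X α : Type} [TopologicalSpace X]
    {rels : Set (FreeGroup α)} {C : (PresentedGroup rels →* SU2) → Prop}
    (f : X → Rep (PresentedGroup rels) C)
    (h : ∀ i : α, Continuous fun p => (f p).hom (PresentedGroup.of i)) : Continuous f := by
  rw [continuous_induced_rng, continuous_pi_iff]
  intro x
  induction x using PresentedGroup.induction_on with
  | _ w =>
    show Continuous fun p => (f p).hom (PresentedGroup.mk rels w)
    induction w using FreeGroup.induction_on with
    | C1 => simpa using continuous_const
    | of i => exact h i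
    | inv_of i hi =>
      simp only [map_inv]
      exact continuous_inv_su2.comp hi
    | mul u v hu hv =>
      simp only [map_mul]
      exact hu.mul hv

/-! ### The holonomy condition in coordinates -/

/-- `cos ν` for `ν = ε sin φ`, as a function of `c = cos φ`. -/
noncomputable def cosHol (ε c : ℝ) : ℝ := Real.cos (ε * Real.sqrt (1 - c ^ 2))

/-- `sin ν / sin φ` for `ν = ε sin φ`, as a function of `c = cos φ`. -/
noncomputable def sinHol (ε c : ℝ) : ℝ := ε * Real.sinc (ε * Real.sqrt (1 - c ^ 2))

theorem sinc_mul_self (x : ℝ) : Real.sinc x * x = Real.sin x := by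
  by_cases h : x = 0
  · simp [h]
  · rw [Real.sinc_of_ne_zero h, div_mul_cancel₀ _ h]

theorem sqrt_one_sub_cos_sq (φ : ℝ) : Real.sqrt (1 - Real.cos φ ^ 2) = |Real.sin φ| := by
  rw [← Real.sin_sq, Real.sqrt_sq_eq_abs]

theorem cosHol_cos (ε φ : ℝ) : cosHol ε (Real.cos φ) = Real.cos (ε * Real.sin φ) := by
  rw [cosHol, sqrt_one_sub_cos_sq]
  rcases abs_choice (Real.sin φ) with h | h <;> rw [h]
  rw [mul_neg, Real.cos_neg]

/-- From `cos φ` only `|sin φ|` is known. As `sinc` is even, the explicit factor `sin φ` carries the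
whole sign. -/
theorem sinHol_cos_mul_sin (ε φ : ℝ) :
    sinHol ε (Real.cos φ) * Real.sin φ = Real.sin (ε * Real.sin φ) := by
  rw [sinHol, sqrt_one_sub_cos_sq, ← sinc_mul_self (ε * Real.sin φ)]
  rcases abs_choice (Real.sin φ) with h | h <;> rw [h]
  · ring
  · rw [mul_neg, Real.sinc_neg]; ring

theorem exists_eq_cos {c : ℝ} (h : c ^ 2 ≤ 1) : ∃ φ : ℝ, c = Real.cos φ :=
  ⟨Real.arccos c, (Real.cos_arccos (by nlinarith) (by nlinarith)).symm⟩

theorem cosHol_sq_add (ε : ℝ) {c : ℝ} (h : c ^ 2 ≤ 1) :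
    cosHol ε c ^ 2 + sinHol ε c ^ 2 * (1 - c ^ 2) = 1 := by
  obtain ⟨φ, rfl⟩ := exists_eq_cos h
  rw [← Real.sin_sq, ← mul_pow, sinHol_cos_mul_sin, cosHol_cos, Real.cos_sq_add_sin_sq]

theorem continuous_cosHol (ε : ℝ) : Continuous (cosHol ε) := by
  unfold cosHol; fun_prop

theorem continuous_sinHol (ε : ℝ) : Continuous (sinHol ε) := by
  unfold sinHol
  exact continuous_const.mul (Real.continuous_sinc.comp (by fun_prop))

theorem sqrt_one_sub_sq_le_one (c : ℝ) : Real.sqrt (1 - c ^ 2) ≤ 1 :=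
  Real.sqrt_le_one.2 (by nlinarith [sq_nonneg c])

/-- The angle is at most `1/2`, so its cosine is at least `7/8`. The threshold `1/2` is the one
shared with `sinHol_lt`. -/
theorem cosHol_gt {ε : ℝ} (hε : ε ∈ Set.Ioo 0 (1 / 2)) (c : ℝ) : 1 / 2 < cosHol ε c := by
  have h1 := sqrt_one_sub_sq_le_one c
  have h2 := Real.sqrt_nonneg (1 - c ^ 2)
  have h3 := Real.one_sub_sq_div_two_le_cos (x := ε * Real.sqrt (1 - c ^ 2))
  have h4 : (ε * Real.sqrt (1 - c ^ 2)) ^ 2 ≤ (1 / 2) ^ 2 := by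
    apply pow_le_pow_left₀ (mul_nonneg hε.1.le h2)
    nlinarith [hε.1, hε.2]
  rw [cosHol]
  linarith

theorem sinHol_pos {ε : ℝ} (hε : ε ∈ Set.Ioo 0 (1 / 2)) (c : ℝ) : 0 < sinHol ε c := by
  have h1 := sqrt_one_sub_sq_le_one c
  have h2 := Real.sqrt_nonneg (1 - c ^ 2)
  apply mul_pos hε.1
  by_cases h : ε * Real.sqrt (1 - c ^ 2) = 0
  · simp [h]
  · rw [Real.sinc_of_ne_zero h]
    have h3 : 0 < ε * Real.sqrt (1 - c ^ 2) := (mul_nonneg hε.1.le h2).lt_of_ne' h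
    refine div_pos (Real.sin_pos_of_pos_of_lt_pi h3 ?_) h3
    nlinarith [hε.1, hε.2, Real.pi_gt_three]

theorem sinHol_lt {ε : ℝ} (hε : ε ∈ Set.Ioo 0 (1 / 2)) (c : ℝ) : sinHol ε c < 1 / 2 := by
  have := Real.sinc_le_one (ε * Real.sqrt (1 - c ^ 2))
  rw [sinHol]
  nlinarith [hε.1, hε.2]

/-- The angles lie in `[0, π]`, where `cos` is injective. The trace of `B` thus sees the height on
the sphere only up to sign. -/
theorem sq_eq_of_cosHol_eq {ε : ℝ} (hε : ε ∈ Set.Ioo 0 (1 / 2)) {c d : ℝ} (hc : c ^ 2 ≤ 1)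
    (hd : d ^ 2 ≤ 1) (h : cosHol ε c = cosHol ε d) : c ^ 2 = d ^ 2 := by
  have key : ∀ e : ℝ, ε * Real.sqrt (1 - e ^ 2) ∈ Set.Icc 0 Real.pi := fun e =>
    ⟨mul_nonneg hε.1.le (Real.sqrt_nonneg _), by
      nlinarith [hε.1, hε.2, Real.pi_gt_three, sqrt_one_sub_sq_le_one e,
        Real.sqrt_nonneg (1 - e ^ 2)]⟩
  have h1 := Real.injOn_cos (key c) (key d) h
  have h2 := mul_left_cancel₀ hε.1.ne' h1
  rw [Real.sqrt_inj (by linarith) (by linarith)] at h2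
  linarith

theorem cosHol_congr {ε c d : ℝ} (h : c ^ 2 = d ^ 2) : cosHol ε c = cosHol ε d := by
  rw [cosHol, h, cosHol]

theorem sinHol_congr {ε c d : ℝ} (h : c ^ 2 = d ^ 2) : sinHol ε c = sinHol ε d := by
  rw [sinHol, h, sinHol]

/-- The pair `(φ, r)` in the polar form is not unique, but the prescribed value of the meridian
depends only on the longitude matrix. One polar form therefore tests the condition for all. -/
theorem holonomyCond_iff (ε : ℝ) (ρ : TangleGroup →* SU2) :
    HolonomyCond ε ρ ↔ qre (ρ muP) = cosHol ε (qre (ρ lambdaP)) ∧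
      qx (ρ muP) = sinHol ε (qre (ρ lambdaP)) * qx (ρ lambdaP) ∧
      qy (ρ muP) = sinHol ε (qre (ρ lambdaP)) * qy (ρ lambdaP) ∧
      qz (ρ muP) = sinHol ε (qre (ρ lambdaP)) * qz (ρ lambdaP) := by
  constructor
  · intro h
    obtain ⟨φ, r, hr, hl⟩ := su2_polar (ρ lambdaP)
    have hm := h φ r hr hl
    rw [coe_eq_quat_iff] at hl hm
    simp only [Pi.smul_apply, smul_eq_mul] at hl hm
    obtain ⟨l0, l1, l2, l3⟩ := hl
    obtain ⟨m0, m1, m2, m3⟩ := hm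
    have := sinHol_cos_mul_sin ε φ
    rw [m0, m1, m2, m3, l0, l1, l2, l3, cosHol_cos, ← this]
    refine ⟨rfl, ?_, ?_, ?_⟩ <;> ring
  · rintro ⟨m0, m1, m2, m3⟩ φ r - hl
    rw [coe_eq_quat_iff] at hl ⊢
    simp only [Pi.smul_apply, smul_eq_mul] at hl ⊢
    obtain ⟨l0, l1, l2, l3⟩ := hl
    have := sinHol_cos_mul_sin ε φ
    rw [m0, m1, m2, m3, l0, l1, l2, l3, cosHol_cos, ← this]
    refine ⟨rfl, ?_, ?_, ?_⟩ <;> ring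

/-! ### The explicit representations -/

theorem sphere_coords (p : S2) : p.1 0 ^ 2 + p.1 1 ^ 2 + p.1 2 ^ 2 = 1 := by
  have h := p.2
  rw [mem_sphere_zero_iff_norm, EuclideanSpace.norm_eq, Real.sqrt_eq_one] at h
  simpa [Fin.sum_univ_three] using h

theorem sphere_z_sq_le (p : S2) : p.1 2 ^ 2 ≤ 1 := by
  nlinarith [sphere_coords p, sq_nonneg (p.1 0), sq_nonneg (p.1 1)]

/-- The quantity `cos² ν + sin² ν sin² θ` as a function on the sphere. -/
noncomputable def sphDen (ε : ℝ) (p : S2) : ℝ :=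
  cosHol ε (p.1 2) ^ 2 + (sinHol ε (p.1 2) * p.1 1) ^ 2

theorem sphDen_pos {ε : ℝ} (hε : ε ∈ Set.Ioo 0 (1 / 2)) (p : S2) : 0 < sphDen ε p := by
  have := cosHol_gt hε (p.1 2)
  unfold sphDen
  positivity

/-- The reciprocal square root of `sphDen`. -/
noncomputable def sphScale (ε : ℝ) (p : S2) : ℝ := (Real.sqrt (sphDen ε p))⁻¹

theorem sphScale_pos {ε : ℝ} (hε : ε ∈ Set.Ioo 0 (1 / 2)) (p : S2) : 0 < sphScale ε p :=
  inv_pos.2 (Real.sqrt_pos.2 (sphDen_pos hε p))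

theorem sphScale_sq_mul {ε : ℝ} (hε : ε ∈ Set.Ioo 0 (1 / 2)) (p : S2) :
    sphScale ε p ^ 2 * (cosHol ε (p.1 2) ^ 2 + (sinHol ε (p.1 2) * p.1 1) ^ 2) = 1 := by
  have h := sphDen_pos hε p
  rw [sphScale, inv_pow, Real.sq_sqrt h.le]
  exact inv_mul_cancel₀ h.ne'

/-- The value on the longitude `h⁻¹ A`. -/
noncomputable def lonVal (p : S2) : SU2 :=
  mkSU2 (p.1 2) (p.1 0) (p.1 1) 0 (by linarith [sphere_coords p])

/-- The value on the meridian `B`. -/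
noncomputable def merVal (ε : ℝ) (p : S2) : SU2 :=
  mkSU2 (cosHol ε (p.1 2)) (sinHol ε (p.1 2) * p.1 0) (sinHol ε (p.1 2) * p.1 1) 0 (by
    have h := cosHol_sq_add ε (sphere_z_sq_le p)
    linear_combination h + sinHol ε (p.1 2) ^ 2 * sphere_coords p)

/-- The value on `h`. -/
noncomputable def hVal {ε : ℝ} (hε : ε ∈ Set.Ioo 0 (1 / 2)) (p : S2) : SU2 :=
  mkSU2 0 (sphScale ε p * cosHol ε (p.1 2)) 0 (-(sphScale ε p * (sinHol ε (p.1 2) * p.1 1))) (by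
    linear_combination sphScale_sq_mul hε p)

/-- The central element `-1`. -/
noncomputable def negOne : SU2 := mkSU2 (-1) 0 0 0 (by norm_num)

/-- The values on the generators. -/
noncomputable def genVal {ε : ℝ} (hε : ε ∈ Set.Ioo 0 (1 / 2)) (p : S2) : TangleGen → SU2
  | .A => hVal hε p * lonVal p
  | .B => merVal ε p
  | .a => unitZ
  | .b => hVal hε p * unitZ⁻¹ * negOne⁻¹ * (hVal hε p)⁻¹
  | .h => hVal hε p
  | .w => negOne

theorem genVal_rel {ε : ℝ} (hε : ε ∈ Set.Ioo 0 (1 / 2)) (p : S2) :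
    ∀ r ∈ tangleRels, FreeGroup.lift (genVal hε p) r = 1 := by
  rintro r (rfl | rfl) <;>
    simp only [fg, map_mul, map_inv, FreeGroup.lift_apply_of, genVal, mul_inv_eq_one]
  -- The relator defining `b` holds by the choice of `genVal`; only the relation `h w a B = a B h`
  -- needs a computation.
  apply su2_ext <;>
    simp only [qre_mul, qx_mul, qy_mul, qz_mul, hVal, merVal, unitZ, negOne, qre_mk, qx_mk,
      qy_mk, qz_mk] <;> ring

/-- The representation with parameter `p`. -/
noncomputable def sphRep {ε : ℝ} (hε : ε ∈ Set.Ioo 0 (1 / 2)) (p : S2) : PerturbedRep ε :=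
  ⟨PresentedGroup.toGroup (genVal_rel hε p), by
    have hg : ∀ i, PresentedGroup.toGroup (genVal_rel hε p) (pg i) = genVal hε p i := fun i =>
      PresentedGroup.toGroup.of (genVal_rel hε p)
    refine ⟨?_, ?_, ?_, ?_, (holonomyCond_iff _ _).2 ?_⟩
    · rw [hg, isTraceless_iff, genVal, unitZ, qre_mk]
    · rw [hg, isTraceless_iff]
      simp only [genVal, qre_mul, qx_mul, qy_mul, qz_mul, qre_inv, qx_inv, qy_inv, qz_inv, hVal,
        unitZ, negOne, qre_mk, qx_mk, qy_mk, qz_mk]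
      ring
    · rw [hg, isTraceless_iff, genVal, hVal, qre_mk]
    · rw [hg, coe_eq_neg_one_iff]
      simp [genVal, negOne, qre_mk, qx_mk, qy_mk, qz_mk]
    · simp only [muP, lambdaP, map_mul, map_inv, hg, genVal, inv_mul_cancel_left, merVal, lonVal,
        qre_mk, qx_mk, qy_mk, qz_mk, mul_zero, and_self]⟩

theorem sphRep_apply {ε : ℝ} (hε : ε ∈ Set.Ioo 0 (1 / 2)) (p : S2) (i : TangleGen) :
    (sphRep hε p).hom (pg i) = genVal hε p i :=
  PresentedGroup.toGroup.of (genVal_rel hε p)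

theorem continuous_coord (i : Fin 3) : Continuous fun p : S2 => p.1 i := by fun_prop

theorem continuous_sphScale {ε : ℝ} (hε : ε ∈ Set.Ioo 0 (1 / 2)) :
    Continuous (sphScale ε) := by
  refine Continuous.inv₀ (Real.continuous_sqrt.comp ?_) fun p =>
    (Real.sqrt_pos.2 (sphDen_pos hε p)).ne'
  exact (((continuous_cosHol ε).comp (continuous_coord 2)).pow 2).add
    ((((continuous_sinHol ε).comp (continuous_coord 2)).mul (continuous_coord 1)).pow 2)

theorem continuous_hVal {ε : ℝ} (hε : ε ∈ Set.Ioo 0 (1 / 2)) : Continuous (hVal hε) := by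
  have hC := (continuous_cosHol ε).comp (continuous_coord 2)
  have hk := (continuous_sinHol ε).comp (continuous_coord 2)
  exact continuous_mkSU2 _ continuous_const ((continuous_sphScale hε).mul hC) continuous_const
    ((continuous_sphScale hε).mul (hk.mul (continuous_coord 1))).neg

theorem continuous_merVal (ε : ℝ) : Continuous (merVal ε) := by
  have hC := (continuous_cosHol ε).comp (continuous_coord 2)
  have hk := (continuous_sinHol ε).comp (continuous_coord 2)
  exact continuous_mkSU2 _ hC (hk.mul (continuous_coord 0)) (hk.mul (continuous_coord 1))
    continuous_const

theorem continuous_sphRep {ε : ℝ} (hε : ε ∈ Set.Ioo 0 (1 / 2)) : Continuous (sphRep hε) := by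
  have hh := continuous_hVal hε
  apply continuous_rep_of_generators
  intro i
  have : (fun p => (sphRep hε p).hom (PresentedGroup.of i)) = fun p => genVal hε p i :=
    funext fun p => sphRep_apply hε p i
  rw [this]
  cases i with
  | A =>
    exact hh.mul (continuous_mkSU2 _ (continuous_coord 2) (continuous_coord 0)
      (continuous_coord 1) continuous_const)
  | B => exact continuous_merVal ε
  | a => exact continuous_const
  | b => exact ((hh.mul continuous_const).mul continuous_const).mul (continuous_inv_su2.comp hh)
  | h => exact hh
  | w => exact continuous_const

/-! ### The parametrization of the perturbed character variety -/

theorem cls_eq_of_generators {α : Type} {rels : Set (FreeGroup α)}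
    {C : (PresentedGroup rels →* SU2) → Prop} {ρ ρ' : Rep (PresentedGroup rels) C} (g : SU2)
    (h : ∀ i : α, ρ'.hom (PresentedGroup.of i) = g * ρ.hom (PresentedGroup.of i) * g⁻¹) :
    ρ.cls = ρ'.cls := by
  refine Rep.cls_eq_iff.2 ⟨g, fun x => ?_⟩
  have : ρ'.hom = (MulAut.conj g).toMonoidHom.comp ρ.hom := PresentedGroup.ext fun i => h i
  rw [this]
  rfl

theorem tangle_rel_comm (ρ : TangleGroup →* SU2) :
    ρ (pg .h) * ρ (pg .w) * ρ (pg .a) * ρ (pg .B) = ρ (pg .a) * ρ (pg .B) * ρ (pg .h) := by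
  have : pg .h * pg .w * pg .a * pg .B = pg .a * pg .B * pg .h := by
    rw [← mul_inv_eq_one]
    exact PresentedGroup.one_of_mem (rels := tangleRels) (Or.inl rfl)
  simpa using congrArg ρ this

theorem tangle_rel_b (ρ : TangleGroup →* SU2) :
    ρ (pg .b) = ρ (pg .h) * (ρ (pg .a))⁻¹ * (ρ (pg .w))⁻¹ * (ρ (pg .h))⁻¹ := by
  have : pg .b = pg .h * (pg .a)⁻¹ * (pg .w)⁻¹ * (pg .h)⁻¹ := by
    rw [← mul_inv_eq_one]
    exact PresentedGroup.one_of_mem (rels := tangleRels) (Or.inr rfl)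
  simpa using congrArg ρ this

theorem sphRep_lambdaP {ε : ℝ} (hε : ε ∈ Set.Ioo 0 (1 / 2)) (p : S2) :
    (sphRep hε p).hom lambdaP = lonVal p := by
  rw [lambdaP, map_mul, map_inv, sphRep_apply, sphRep_apply]
  exact inv_mul_cancel_left _ _

theorem sphere_ext {p q : S2} (h0 : p.1 0 = q.1 0) (h1 : p.1 1 = q.1 1) (h2 : p.1 2 = q.1 2) :
    p = q := by
  apply Subtype.ext
  ext i
  fin_cases i
  exacts [h0, h1, h2]

/-- Three trace functions separating the points of the perturbed character variety. -/
noncomputable def traceCoords (ε : ℝ) (x : RPert ε) : ℝ × ℝ × ℝ :=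
  (CharVar.traceFun lambdaP x, CharVar.traceFun (pg .h * lambdaP) x,
    CharVar.traceFun (pg .a * pg .h) x)

theorem continuous_traceCoords (ε : ℝ) : Continuous (traceCoords ε) :=
  (CharVar.continuous_traceFun _).prodMk
    ((CharVar.continuous_traceFun _).prodMk (CharVar.continuous_traceFun _))

theorem traceCoords_sphRep {ε : ℝ} (hε : ε ∈ Set.Ioo 0 (1 / 2)) (p : S2) :
    traceCoords ε (sphRep hε p).cls =
      (p.1 2, -(sphScale ε p * cosHol ε (p.1 2) * p.1 0),
        sphScale ε p * (sinHol ε (p.1 2) * p.1 1)) := by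
  simp only [traceCoords, CharVar.traceFun_cls, map_mul, sphRep_lambdaP, sphRep_apply, genVal,
    hVal, lonVal, unitZ, qre_mul, qre_mk, qx_mk, qy_mk, qz_mk]
  ext <;> ring

/-- The first trace is the height `z`. The third gives scale times `sinHol · y`, after which the
normalization of `h` gives the square of scale times `cosHol`. Positivity yields the scale itself,
then `x` and `y`. -/
theorem injective_traceCoords_sphRep {ε : ℝ} (hε : ε ∈ Set.Ioo 0 (1 / 2)) :
    Function.Injective fun p => traceCoords ε (sphRep hε p).cls := by
  intro p q h
  simp only [traceCoords_sphRep, Prod.mk.injEq] at h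
  obtain ⟨hz, hx, hy⟩ := h
  have Cp := cosHol_gt hε (q.1 2)
  have kp := sinHol_pos hε (q.1 2)
  have Dp := sphScale_sq_mul hε p
  have Dq := sphScale_sq_mul hε q
  have Sp := sphScale_pos hε p
  have Sq := sphScale_pos hε q
  rw [hz] at hx hy Dp
  have hs : sphScale ε p = sphScale ε q := by
    have h1 : (sphScale ε p * cosHol ε (q.1 2)) ^ 2 = (sphScale ε q * cosHol ε (q.1 2)) ^ 2 := by
      linear_combination Dp - Dq - (sphScale ε p * (sinHol ε (q.1 2) * p.1 1) +
        sphScale ε q * (sinHol ε (q.1 2) * q.1 1)) * hy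
    have h2 := (pow_left_inj₀ (by positivity) (by positivity) two_ne_zero).1 h1
    exact mul_right_cancel₀ (by positivity) h2
  rw [hs] at hx hy
  refine sphere_ext ?_ ?_ hz
  · exact mul_left_cancel₀ (by positivity) (neg_injective hx)
  · exact mul_left_cancel₀ kp.ne' (mul_left_cancel₀ Sq.ne' hy)

/-- The relation `h w X = X h` with `w = -1` says that `h` and `X` are orthogonal. -/
theorem orthogonal_of_anticomm {h w X : SU2} (hh : qre h = 0) (hw : w.1 = -1)
    (hX : h * w * X = X * h) : qre X = 0 ∧ qre (h * X) = 0 := by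
  obtain ⟨w0, w1, w2, w3⟩ := (coe_eq_neg_one_iff w).1 hw
  have e0 := congrArg qre hX
  have e1 := congrArg qx hX
  have e2 := congrArg qy hX
  have e3 := congrArg qz hX
  have N := coords_norm h
  simp only [qre_mul, qx_mul, qy_mul, qz_mul, w0, w1, w2, w3, hh] at e0 e1 e2 e3 N ⊢
  -- In the vector part the cross products agree on both sides, leaving `qre X` times the unit
  -- vector of `h`.
  have f1 : qre X * qx h = 0 := by linarith
  have f2 : qre X * qy h = 0 := by linarith
  have f3 : qre X * qz h = 0 := by linarith
  refine ⟨?_, by linarith⟩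
  linear_combination (-qre X) * N + qx h * f1 + qy h * f2 + qz h * f3

theorem eq_zero_of_sum_sq_eq_zero {x y z : ℝ} (h : x ^ 2 + y ^ 2 + z ^ 2 = 0) :
    x = 0 ∧ y = 0 ∧ z = 0 := by
  refine ⟨?_, ?_, ?_⟩ <;> refine pow_eq_zero_iff two_ne_zero |>.1 ?_ <;>
    linarith [sq_nonneg x, sq_nonneg y, sq_nonneg z]

/-- Conjugation is linear on vector parts. -/
theorem conj_coords_of_proportional {B l : SU2} {k : ℝ} (g : SU2) (h1 : qx B = k * qx l)
    (h2 : qy B = k * qy l) (h3 : qz B = k * qz l) :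
    qx (g * B * g⁻¹) = k * qx (g * l * g⁻¹) ∧ qy (g * B * g⁻¹) = k * qy (g * l * g⁻¹) ∧
      qz (g * B * g⁻¹) = k * qz (g * l * g⁻¹) := by
  simp only [qre_mul, qx_mul, qy_mul, qz_mul, qre_inv, qx_inv, qy_inv, qz_inv, h1, h2, h3]
  refine ⟨?_, ?_, ?_⟩ <;> ring

/-- A triple `a`, `h`, `l` with `B` determined by `l` can be conjugated to standard position. -/
theorem exists_conj_standard {ε : ℝ} (hε : ε ∈ Set.Ioo 0 (1 / 2)) {a h w l B : SU2}
    (ha : qre a = 0) (hh : qre h = 0) (hw : w.1 = -1) (hrel : h * w * (a * B) = a * B * h)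
    (hB0 : qre B = cosHol ε (qre l)) (hB1 : qx B = sinHol ε (qre l) * qx l)
    (hB2 : qy B = sinHol ε (qre l) * qy l) (hB3 : qz B = sinHol ε (qre l) * qz l) :
    ∃ g : SU2, g * a * g⁻¹ = unitZ ∧ 0 < qx (g * h * g⁻¹) ∧ qy (g * h * g⁻¹) = 0 := by
  obtain ⟨hX, hhX⟩ := orthogonal_of_anticomm hh hw hrel
  have Cp := cosHol_gt hε (qre l)
  have kp := sinHol_pos hε (qre l)
  have Na := coords_norm a
  have Nh := coords_norm h
  simp only [qre_mul, qx_mul, qy_mul, qz_mul, ha, hh, hB0, hB1, hB2, hB3] at hX hhX Na Nh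
  obtain ⟨d, hd⟩ : ∃ d, d = qx h * qx a + qy h * qy a + qz h * qz a := ⟨_, rfl⟩
  -- Lagrange's identity `|h|²|a|² - (h·a)² = |h × a|²` for unit vectors.
  have hL : 1 - d ^ 2 = (qy h * qz a - qz h * qy a) ^ 2 + (qz h * qx a - qx h * qz a) ^ 2 +
      (qx h * qy a - qy h * qx a) ^ 2 := by
    linear_combination (-1 : ℝ) * Nh - (qx h ^ 2 + qy h ^ 2 + qz h ^ 2) * Na -
      (d + (qx h * qx a + qy h * qy a + qz h * qz a)) * hd
  -- If `h × a = 0`, orthogonality of `h` and `aB` reduces to `cosHol · d = 0`, so `d = 0`,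
  -- contradicting `d² = 1`.
  have hpos : 0 < 1 - d ^ 2 := by
    refine lt_of_le_of_ne (by rw [hL]; positivity) fun h0 => ?_
    rw [← h0] at hL
    obtain ⟨f1, f2, f3⟩ := eq_zero_of_sum_sq_eq_zero hL.symm
    have f4 : cosHol ε (qre l) * d = 0 := by
      rw [hd]
      linear_combination (-1 : ℝ) * hhX + sinHol ε (qre l) * (qx l * f1 + qy l * f2 + qz l * f3)
    have f5 : d = 0 := by
      rcases mul_eq_zero.1 f4 with f | f
      · linarith
      · exact f
    rw [f5] at h0
    norm_num at h0
  have hs : (Real.sqrt (1 - d ^ 2))⁻¹ ^ 2 * (1 - d ^ 2) = 1 := by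
    rw [inv_pow, Real.sq_sqrt hpos.le, inv_mul_cancel₀ hpos.ne']
  have cp : 0 < (Real.sqrt (1 - d ^ 2))⁻¹ := inv_pos.2 (Real.sqrt_pos.2 hpos)
  generalize (Real.sqrt (1 - d ^ 2))⁻¹ = c at hs cp
  -- Gram–Schmidt: `e₁` is the normalized component of `h` orthogonal to `a`, so `h` has positive
  -- first and zero second coordinate.
  obtain ⟨g, hg⟩ := exists_frame (e₃ := a)
    (e₁ := mkSU2 0 (c * (qx h - d * qx a)) (c * (qy h - d * qy a)) (c * (qz h - d * qz a)) (by
      linear_combination hs + c ^ 2 * Nh + c ^ 2 * d ^ 2 * Na + 2 * c ^ 2 * d * hd))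
    (qre_mk _ _ _ _ _) ha (by
      simp only [qre_mul, qre_mk, qx_mk, qy_mk, qz_mk, ha]
      linear_combination c * hd + c * d * Na)
  refine ⟨g, ?_, ?_, ?_⟩
  · obtain ⟨g0, g1, g2, g3⟩ := hg a
    apply su2_ext
    · rw [g0, ha, unitZ, qre_mk]
    · rw [g1, unitZ, qx_mk]
      simp only [qre_mul, qre_mk, qx_mk, qy_mk, qz_mk, ha]
      linear_combination (-c) * hd - c * d * Na
    · rw [g2, unitZ, qy_mk]
      simp only [qre_mul, qx_mul, qy_mul, qz_mul, qre_mk, qx_mk, qy_mk, qz_mk, ha]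
      ring
    · rw [g3, unitZ, qz_mk]
      simp only [qre_mul, ha]
      linear_combination Na
  · obtain ⟨g0, g1, g2, g3⟩ := hg h
    have : qx (g * h * g⁻¹) = c * (1 - d ^ 2) := by
      rw [g1]
      simp only [qre_mul, qre_mk, qx_mk, qy_mk, qz_mk, hh]
      linear_combination c * Nh + c * d * hd
    rw [this]
    positivity
  · obtain ⟨g0, g1, g2, g3⟩ := hg h
    rw [g2]
    simp only [qre_mul, qx_mul, qy_mul, qz_mul, qre_mk, qx_mk, qy_mk, qz_mk, hh, ha]
    ring

/-- In standard position tracelessness of `aB` reads `sinHol · qz l = 0`, so `l` is a point of the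
sphere. Orthogonality reads `cosHol · qz h = -sinHol · qy l · qx h`; together with `|h| = 1` and `qx
h > 0` this determines `h`. -/
theorem exists_sphRep_cls_eq {ε : ℝ} (hε : ε ∈ Set.Ioo 0 (1 / 2)) (ρ : PerturbedRep ε) :
    ∃ p : S2, (sphRep hε p).cls = ρ.cls := by
  obtain ⟨ρ, ha, hb, hh, hw, hol⟩ := ρ
  rw [isTraceless_iff] at ha hh
  have hrel := tangle_rel_comm ρ
  have hrelb := tangle_rel_b ρ
  obtain ⟨B0, B1, B2, B3⟩ := (holonomyCond_iff ε ρ).1 hol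
  have hA : ρ (pg .A) = ρ (pg .h) * ρ lambdaP := by
    rw [lambdaP, map_mul, map_inv, mul_inv_cancel_left]
  rw [mul_assoc _ (ρ (pg .a))] at hrel
  obtain ⟨g, hga, hgx, hgy⟩ := exists_conj_standard hε ha hh hw hrel B0 B1 B2 B3
  obtain ⟨B1', B2', B3'⟩ := conj_coords_of_proportional g B1 B2 B3
  have hcj : ∀ U V : SU2, g * (U * V) * g⁻¹ = (g * U * g⁻¹) * (g * V * g⁻¹) := fun U V => by group
  have hrel' := congrArg (fun U => g * U * g⁻¹) hrel
  simp only [hcj] at hrel'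
  have hw' : g * ρ (pg .w) * g⁻¹ = negOne := by
    have : ρ (pg .w) = negOne := Subtype.ext (hw.trans ((coe_eq_neg_one_iff _).2
      ⟨qre_mk _ _ _ _ _, qx_mk _ _ _ _ _, qy_mk _ _ _ _ _, qz_mk _ _ _ _ _⟩).symm)
    rw [this]
    apply su2_ext <;>
      simp only [qre_mul, qx_mul, qy_mul, qz_mul, qre_inv, qx_inv, qy_inv, qz_inv, negOne, qre_mk,
        qx_mk, qy_mk, qz_mk]
    · linear_combination (-1 : ℝ) * coords_norm g
    all_goals ring
  have B0' : qre (g * ρ muP * g⁻¹) = cosHol ε (qre (g * ρ lambdaP * g⁻¹)) := by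
    rw [qre_conj, qre_conj, B0]
  rw [← qre_conj g (ρ lambdaP)] at B1' B2' B3'
  have hh' : qre (g * ρ (pg .h) * g⁻¹) = 0 := by rw [qre_conj, hh]
  have hbb := congrArg (fun U => g * U * g⁻¹) hrelb
  have hAA := congrArg (fun U => g * U * g⁻¹) hA
  have hci : ∀ U : SU2, g * U⁻¹ * g⁻¹ = (g * U * g⁻¹)⁻¹ := fun U => by group
  simp only [hcj, hci, hw', hga] at hbb hAA hrel'
  have hmu : ρ muP = ρ (pg .B) := rfl
  rw [← hmu] at hrel'
  -- It is enough to match `h`, `l` and `B`: `A = h l`, and `b` is a word in `a`, `h`, `w`.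
  have hgen : ∀ p : S2, hVal hε p = g * ρ (pg .h) * g⁻¹ → lonVal p = g * ρ lambdaP * g⁻¹ →
      merVal ε p = g * ρ muP * g⁻¹ →
      (sphRep hε p).cls = (⟨ρ, (isTraceless_iff _).2 ha, hb, (isTraceless_iff _).2 hh, hw, hol⟩ :
        PerturbedRep ε).cls := by
    intro p h1 h2 h3
    refine (cls_eq_of_generators g fun i => ?_).symm
    refine (sphRep_apply hε p i).trans ?_
    cases i with
    | A => exact (congrArg₂ _ h1 h2).trans hAA.symm
    | B => exact h3
    | a => exact hga.symm
    | b => exact (by rw [genVal, h1] : _ = _).trans hbb.symm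
    | h => exact h1
    | w => exact hw'.symm
  generalize g * ρ (pg .h) * g⁻¹ = h at *
  generalize g * ρ lambdaP * g⁻¹ = l at *
  generalize g * ρ muP * g⁻¹ = B at *
  obtain ⟨hX, hhX⟩ := orthogonal_of_anticomm hh' (show negOne.1 = -1 from
    (coe_eq_neg_one_iff _).2 ⟨qre_mk _ _ _ _ _, qx_mk _ _ _ _ _, qy_mk _ _ _ _ _,
      qz_mk _ _ _ _ _⟩) hrel'
  simp only [qre_mul, qx_mul, qy_mul, qz_mul, unitZ, qre_mk, qx_mk, qy_mk, qz_mk, hh', hgy,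
    B0', B1', B2', B3'] at hX hhX
  have Cp := cosHol_gt hε (qre l)
  have kp := sinHol_pos hε (qre l)
  have Nh := coords_norm h
  have Nl := coords_norm l
  rw [hh', hgy] at Nh
  have hlz : qz l = 0 := by
    have : sinHol ε (qre l) * qz l = 0 := by linarith
    exact (mul_eq_zero.1 this).resolve_left kp.ne'
  rw [hlz] at Nl
  let p : S2 := ⟨!₂[qx l, qy l, qre l], by
    rw [mem_sphere_zero_iff_norm, EuclideanSpace.norm_eq, Real.sqrt_eq_one]
    simp [Fin.sum_univ_three]
    linarith⟩
  have p0 : p.1 0 = qx l := rfl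
  have p1 : p.1 1 = qy l := rfl
  have p2 : p.1 2 = qre l := rfl
  have Dp := sphScale_sq_mul hε p
  have Sp := sphScale_pos hε p
  rw [p1, p2] at Dp
  have hhz : cosHol ε (qre l) * qz h = -(sinHol ε (qre l) * qy l * qx h) := by linarith
  have hhx : qx h = sphScale ε p * cosHol ε (qre l) := by
    refine (pow_left_inj₀ hgx.le (by positivity) two_ne_zero).1 ?_
    have key : qx h ^ 2 * (cosHol ε (qre l) ^ 2 + (sinHol ε (qre l) * qy l) ^ 2) =
        cosHol ε (qre l) ^ 2 := by
      linear_combination cosHol ε (qre l) ^ 2 * Nh -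
        (cosHol ε (qre l) * qz h - sinHol ε (qre l) * qy l * qx h) * hhz
    linear_combination sphScale ε p ^ 2 * key - qx h ^ 2 * Dp
  have hhz' : qz h = -(sphScale ε p * (sinHol ε (qre l) * qy l)) := by
    have hC : cosHol ε (qre l) ≠ 0 := by positivity
    apply mul_left_cancel₀ hC
    rw [hhz, hhx]
    ring
  refine ⟨p, hgen p ?_ ?_ ?_⟩
  · apply su2_ext <;> simp only [hVal, qre_mk, qx_mk, qy_mk, qz_mk, p1, p2, hh', hgy, hhx, hhz']
  · apply su2_ext <;> simp only [lonVal, qre_mk, qx_mk, qy_mk, qz_mk, p0, p1, p2, hlz]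
  · apply su2_ext <;> simp only [merVal, qre_mk, qx_mk, qy_mk, qz_mk, p0, p1, p2, hlz, B0', B1',
      B2', B3', mul_zero]

/-- The homeomorphism from the sphere to the perturbed character variety. -/
theorem exists_sphHomeo {ε : ℝ} (hε : ε ∈ Set.Ioo 0 (1 / 2)) :
    ∃ Φ : S2 ≃ₜ RPert ε, ∀ p, Φ p = (sphRep hε p).cls := by
  have hinj := injective_traceCoords_sphRep hε
  have hsurj : Function.Surjective fun p => (sphRep hε p).cls := fun x => by
    obtain ⟨ρ, rfl⟩ := CharVar.exists_rep x
    exact exists_sphRep_cls_eq hε ρ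
  -- Hausdorffness of the quotient follows from a continuous injection into `ℝ³`; a continuous
  -- bijection from the compact sphere is then a homeomorphism.
  have : T2Space (RPert ε) := by
    refine T2Space.of_injective_continuous (f := traceCoords ε) (fun x y h => ?_)
      (continuous_traceCoords ε)
    obtain ⟨p, rfl⟩ := hsurj x
    obtain ⟨q, rfl⟩ := hsurj y
    rw [hinj h]
  let e : S2 ≃ RPert ε := Equiv.ofBijective (fun p => (sphRep hε p).cls)
    ⟨fun p q h => hinj (congrArg (traceCoords ε) h), hsurj⟩
  have he : Continuous e := Rep.continuous_cls.comp (continuous_sphRep hε)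
  exact ⟨he.homeoOfEquivCompactToT2, fun p => rfl⟩

/-! ### The restriction to the punctured torus -/

theorem restrict_cls {ε : ℝ} (ρ : PerturbedRep ε) : restrict ε ρ.cls = (restrictRep ρ).cls := rfl

theorem restrictRep_apply {ε : ℝ} (ρ : PerturbedRep ε) (i : TorusGen) :
    (restrictRep ρ).hom (tg i) = boundaryValue ρ.hom i :=
  PresentedGroup.toGroup.of (boundaryValue_rel ρ)

/-- The values of the restricted representation on the generators. -/
noncomputable def torusVal {ε : ℝ} (hε : ε ∈ Set.Ioo 0 (1 / 2)) (p : S2) : TorusGen → SU2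
  | .A => hVal hε p * lonVal p
  | .B => merVal ε p
  | .a => unitZ
  | .b => hVal hε p * unitZ⁻¹ * negOne⁻¹ * (hVal hε p)⁻¹

theorem restrict_sphRep_apply {ε : ℝ} (hε : ε ∈ Set.Ioo 0 (1 / 2)) (p : S2) (i : TorusGen) :
    (restrictRep (sphRep hε p)).hom (tg i) = torusVal hε p i := by
  rw [restrictRep_apply]
  cases i <;> exact sphRep_apply hε p _

section coords
variable {ε : ℝ} (hε : ε ∈ Set.Ioo 0 (1 / 2)) (p : S2)

theorem torusVal_A_coords :
    qre (torusVal hε p .A) = -(sphScale ε p * cosHol ε (p.1 2) * p.1 0) ∧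
    qx (torusVal hε p .A) = sphScale ε p *
      (cosHol ε (p.1 2) * p.1 2 - sinHol ε (p.1 2) * p.1 1 * p.1 1) ∧
    qy (torusVal hε p .A) = sphScale ε p * (sinHol ε (p.1 2) * p.1 1 * p.1 0) ∧
    qz (torusVal hε p .A) = -(sphScale ε p *
      ((cosHol ε (p.1 2) + sinHol ε (p.1 2) * p.1 2) * p.1 1)) := by
  simp only [torusVal, qre_mul, qx_mul, qy_mul, qz_mul, hVal, lonVal, qre_mk, qx_mk, qy_mk, qz_mk]
  refine ⟨?_, ?_, ?_, ?_⟩ <;> ring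

theorem torusVal_B_coords :
    qre (torusVal hε p .B) = cosHol ε (p.1 2) ∧
    qx (torusVal hε p .B) = sinHol ε (p.1 2) * p.1 0 ∧
    qy (torusVal hε p .B) = sinHol ε (p.1 2) * p.1 1 ∧ qz (torusVal hε p .B) = 0 := by
  simp only [torusVal, merVal, qre_mk, qx_mk, qy_mk, qz_mk, and_self]

theorem torusVal_a_coords :
    qre (torusVal hε p .a) = 0 ∧ qx (torusVal hε p .a) = 0 ∧
    qy (torusVal hε p .a) = 0 ∧ qz (torusVal hε p .a) = 1 := by
  simp only [torusVal, unitZ, qre_mk, qx_mk, qy_mk, qz_mk, and_self]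

theorem torusVal_b_coords :
    qre (torusVal hε p .b) = 0 ∧
    qx (torusVal hε p .b) = -(sphScale ε p ^ 2 *
      (2 * cosHol ε (p.1 2) * (sinHol ε (p.1 2) * p.1 1))) ∧
    qy (torusVal hε p .b) = 0 ∧
    qz (torusVal hε p .b) = -(sphScale ε p ^ 2 *
      (cosHol ε (p.1 2) ^ 2 - (sinHol ε (p.1 2) * p.1 1) ^ 2)) := by
  simp only [torusVal, qre_mul, qx_mul, qy_mul, qz_mul, qre_inv, qx_inv, qy_inv, qz_inv, hVal,
    unitZ, negOne, qre_mk, qx_mk, qy_mk, qz_mk]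
  refine ⟨?_, ?_, ?_, ?_⟩ <;> ring

end coords

/-- At a pole `B` is scalar, `a` and `b` are multiples of `iσ_z`, and `A` is a multiple of `iσ_x`
whose sign is that of `z`. Conjugation by `iσ_z` changes only that sign. -/
theorem restrict_sphRep_eq_of_poles {ε : ℝ} (hε : ε ∈ Set.Ioo 0 (1 / 2)) {p q : S2}
    (hp0 : p.1 0 = 0) (hp1 : p.1 1 = 0) (hq0 : q.1 0 = 0) (hq1 : q.1 1 = 0) :
    restrict ε (sphRep hε p).cls = restrict ε (sphRep hε q).cls := by
  have hp := sphere_coords p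
  have hq := sphere_coords q
  rw [hp0, hp1] at hp
  rw [hq0, hq1] at hq
  have hsq : q.1 2 ^ 2 = p.1 2 ^ 2 := by linarith
  rcases sq_eq_sq_iff_eq_or_eq_neg.1 hsq with h | h
  · rw [sphere_ext (p := p) (q := q) (by rw [hp0, hq0]) (by rw [hp1, hq1]) h.symm]
  · rw [restrict_cls, restrict_cls]
    refine cls_eq_of_generators unitZ fun i => ?_
    refine (restrict_sphRep_apply hε q i).trans
      (.trans ?_ (congrArg _ (restrict_sphRep_apply hε p i).symm |> congrArg (· * unitZ⁻¹)))
    have hs : sphScale ε q = sphScale ε p := by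
      simp only [sphScale, sphDen, cosHol_congr hsq, hp1, hq1, mul_zero]
    obtain ⟨A0, A1, A2, A3⟩ := torusVal_A_coords hε p
    obtain ⟨A0', A1', A2', A3'⟩ := torusVal_A_coords hε q
    obtain ⟨B0, B1, B2, B3⟩ := torusVal_B_coords hε p
    obtain ⟨B0', B1', B2', B3'⟩ := torusVal_B_coords hε q
    obtain ⟨a0, a1, a2, a3⟩ := torusVal_a_coords hε p
    obtain ⟨a0', a1', a2', a3'⟩ := torusVal_a_coords hε q
    obtain ⟨b0, b1, b2, b3⟩ := torusVal_b_coords hε p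
    obtain ⟨b0', b1', b2', b3'⟩ := torusVal_b_coords hε q
    have hC : cosHol ε (-p.1 2) = cosHol ε (p.1 2) := cosHol_congr (by ring)
    cases i <;> apply su2_ext <;>
      simp only [qre_mul, qx_mul, qy_mul, qz_mul, qre_inv, qx_inv, qy_inv, qz_inv, unitZ, qre_mk,
        qx_mk, qy_mk, qz_mk, *] <;> ring

theorem traces_of_restrict_eq {ε : ℝ} (hε : ε ∈ Set.Ioo 0 (1 / 2)) {p q : S2}
    (h : restrict ε (sphRep hε p).cls = restrict ε (sphRep hε q).cls) (i j : TorusGen) :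
    qre (torusVal hε p i) = qre (torusVal hε q i) ∧
      qre (torusVal hε p i * torusVal hε p j) = qre (torusVal hε q i * torusVal hε q j) := by
  rw [restrict_cls, restrict_cls] at h
  have h1 := Rep.qre_eq_of_cls_eq h (tg i)
  have h2 := Rep.qre_eq_of_cls_eq h (tg i * tg j)
  simp only [map_mul, restrict_sphRep_apply] at h1 h2
  exact ⟨h1, h2⟩

/-- The trace of `B` gives `z²`, that of `ab` the scale, that of `A` then `x`, hence `y²`. The trace
of `aA` gives `(cosHol + sinHol · z) y`, whose first factor is positive: it fixes the sign of `y`,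
and also `z` if `y ≠ 0`. If `y = 0`, the trace of `AB` contains a term in `xz`, which gives `z`
unless `x = 0`. -/
theorem eq_or_poles_of_restrict_eq {ε : ℝ} (hε : ε ∈ Set.Ioo 0 (1 / 2)) {p q : S2}
    (h : restrict ε (sphRep hε p).cls = restrict ε (sphRep hε q).cls) :
    p = q ∨ ((p.1 0 = 0 ∧ p.1 1 = 0) ∧ (q.1 0 = 0 ∧ q.1 1 = 0)) := by
  have tB := (traces_of_restrict_eq hε h .B .B).1
  obtain ⟨tA, tAB⟩ := traces_of_restrict_eq hε h .A .B
  have tab := (traces_of_restrict_eq hε h .a .b).2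
  have taA := (traces_of_restrict_eq hε h .a .A).2
  obtain ⟨A0, A1, A2, A3⟩ := torusVal_A_coords hε p
  obtain ⟨A0', A1', A2', A3'⟩ := torusVal_A_coords hε q
  obtain ⟨B0, B1, B2, B3⟩ := torusVal_B_coords hε p
  obtain ⟨B0', B1', B2', B3'⟩ := torusVal_B_coords hε q
  obtain ⟨a0, a1, a2, a3⟩ := torusVal_a_coords hε p
  obtain ⟨a0', a1', a2', a3'⟩ := torusVal_a_coords hε q
  obtain ⟨b0, b1, b2, b3⟩ := torusVal_b_coords hε p
  obtain ⟨b0', b1', b2', b3'⟩ := torusVal_b_coords hε q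
  rw [B0, B0'] at tB
  have hzz := sq_eq_of_cosHol_eq hε (sphere_z_sq_le p) (sphere_z_sq_le q) tB
  have hk : sinHol ε (p.1 2) = sinHol ε (q.1 2) := sinHol_congr hzz
  simp only [qre_mul, A0, A1, A2, A3, A0', A1', A2', A3', B0, B1, B2, B3, B0', B1', B2', B3',
    a0, a1, a2, a3, a0', a1', a2', a3', b0, b1, b2, b3, b0', b1', b2', b3', tB, hk]
    at tA tAB tab taA
  have Dp := sphScale_sq_mul hε p
  have Dq := sphScale_sq_mul hε q
  have Sp := sphScale_pos hε p
  have Sq := sphScale_pos hε q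
  have Np := sphere_coords p
  have Nq := sphere_coords q
  have zp := sphere_z_sq_le p
  have zq := sphere_z_sq_le q
  rw [tB, hk] at Dp
  have Cp := cosHol_gt hε (q.1 2)
  have kp := sinHol_pos hε (q.1 2)
  have kl := sinHol_lt hε (q.1 2)
  generalize cosHol ε (q.1 2) = C at *
  generalize sinHol ε (q.1 2) = k at *
  have hs : sphScale ε p = sphScale ε q := by
    have h1 : (sphScale ε p * C) ^ 2 = (sphScale ε q * C) ^ 2 := by
      -- The trace of `ab` is a difference of the two squares whose sum is normalized to `1`.
      linear_combination (1 / 2) * tab + (1 / 2) * Dp - (1 / 2) * Dq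
    have h2 := (pow_left_inj₀ (by positivity) (by positivity) two_ne_zero).1 h1
    exact mul_right_cancel₀ (by positivity) h2
  rw [hs] at tA tAB taA
  generalize sphScale ε q = s at *
  have hx : p.1 0 = q.1 0 := mul_left_cancel₀ (by positivity) (neg_injective tA)
  have hyy : p.1 1 ^ 2 = q.1 1 ^ 2 := by rw [hx] at Np; linarith
  -- Here smallness of `ε` is used in the form `|k z| ≤ k < 1/2 < C`.
  have hfac : ∀ z : ℝ, z ^ 2 ≤ 1 → 0 < C + k * z := fun z hz => by
    have h1 := (abs_le.1 ((sq_le_one_iff_abs_le_one z).1 hz)).1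
    linarith [mul_le_mul_of_nonneg_left h1 kp.le]
  have fp := hfac _ zp
  have fq := hfac _ zq
  have hyf : (C + k * p.1 2) * p.1 1 = (C + k * q.1 2) * q.1 1 := by
    apply mul_left_cancel₀ Sq.ne'
    linarith
  by_cases hy0 : q.1 1 = 0
  · have hy0' : p.1 1 = 0 := by rw [hy0] at hyy; simpa using hyy
    by_cases hx0 : q.1 0 = 0
    · exact Or.inr ⟨⟨by rw [hx, hx0], hy0'⟩, hx0, hy0⟩
    · left
      refine sphere_ext hx (by rw [hy0, hy0']) ?_
      rw [hx, hy0, hy0'] at tAB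
      apply mul_left_cancel₀ (show s * C * k * q.1 0 ≠ 0 by positivity)
      linarith
  · left
    have hy : p.1 1 = q.1 1 := by
      rcases sq_eq_sq_iff_eq_or_eq_neg.1 hyy with h | h
      · exact h
      · exfalso
        rw [h] at hyf
        have : (C + k * p.1 2 + (C + k * q.1 2)) * q.1 1 = 0 := by linarith
        rcases mul_eq_zero.1 this with h | h
        · linarith
        · exact hy0 h
    refine sphere_ext hx hy ?_
    rw [hy] at hyf
    have := mul_right_cancel₀ hy0 hyf
    exact mul_left_cancel₀ kp.ne' (by linarith)

theorem isNonabelian_cls {G : Type} [Group G] {C : (G →* SU2) → Prop} {ρ : Rep G C} {g k : G}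
    (h : ρ.hom g * ρ.hom k ≠ ρ.hom k * ρ.hom g) : ρ.cls.IsNonabelian := by
  intro ρ' hρ'
  obtain ⟨u, hu⟩ := Rep.cls_eq_iff.1 hρ'
  refine ⟨g, k, fun e => h ?_⟩
  rw [hu, hu]
  calc u * ρ'.hom g * u⁻¹ * (u * ρ'.hom k * u⁻¹) = u * (ρ'.hom g * ρ'.hom k) * u⁻¹ := by group
    _ = u * (ρ'.hom k * ρ'.hom g) * u⁻¹ := by rw [e]
    _ = _ := by group

/-- Away from the poles `B` has a nonzero horizontal vector part and does not commute with `a =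
iσ_z`. At the poles `B` is central, but `A` is a nonzero multiple of `iσ_x`. -/
theorem isNonabelian_restrict_sphRep {ε : ℝ} (hε : ε ∈ Set.Ioo 0 (1 / 2)) (p : S2) :
    (restrict ε (sphRep hε p).cls).IsNonabelian := by
  rw [restrict_cls]
  obtain ⟨A0, A1, A2, A3⟩ := torusVal_A_coords hε p
  obtain ⟨B0, B1, B2, B3⟩ := torusVal_B_coords hε p
  obtain ⟨a0, a1, a2, a3⟩ := torusVal_a_coords hε p
  have Cp := cosHol_gt hε (p.1 2)
  have kp := sinHol_pos hε (p.1 2)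
  have Sp := sphScale_pos hε p
  have N := sphere_coords p
  by_cases h : p.1 0 = 0 ∧ p.1 1 = 0
  · refine isNonabelian_cls (g := tg .a) (k := tg .A) fun e => ?_
    rw [restrict_sphRep_apply, restrict_sphRep_apply] at e
    have ey := congrArg qy e
    simp only [qy_mul, A0, A1, A2, A3, a0, a1, a2, a3, h.1, h.2] at ey
    rw [h.1, h.2] at N
    have : sphScale ε p * cosHol ε (p.1 2) * p.1 2 = 0 := by linarith
    rw [(mul_eq_zero.1 this).resolve_left (by positivity)] at N
    norm_num at N
  · refine isNonabelian_cls (g := tg .a) (k := tg .B) fun e => h ?_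
    rw [restrict_sphRep_apply, restrict_sphRep_apply] at e
    have ex := congrArg qx e
    have ey := congrArg qy e
    simp only [qx_mul, qy_mul, B0, B1, B2, B3, a0, a1, a2, a3] at ex ey
    have h0 : sinHol ε (p.1 2) * p.1 0 = 0 := by linarith
    have h1 : sinHol ε (p.1 2) * p.1 1 = 0 := by linarith
    exact ⟨(mul_eq_zero.1 h0).resolve_left kp.ne', (mul_eq_zero.1 h1).resolve_left kp.ne'⟩

/-! ### Spherical coordinates -/

theorem sph_x (φ θ : ℝ) : (sph φ θ).1 0 = Real.sin φ * Real.cos θ := rfl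
theorem sph_y (φ θ : ℝ) : (sph φ θ).1 1 = Real.sin φ * Real.sin θ := rfl
theorem sph_z (φ θ : ℝ) : (sph φ θ).1 2 = Real.cos φ := rfl

theorem eq_pole_iff (p : S2) : p = northPole ∨ p = southPole ↔ p.1 0 = 0 ∧ p.1 1 = 0 := by
  constructor
  · rintro (rfl | rfl) <;> simp [northPole, southPole, sph_x, sph_y]
  · rintro ⟨h0, h1⟩
    have N := sphere_coords p
    rw [h0, h1] at N
    have hz : p.1 2 ^ 2 = 1 := by linarith
    rcases sq_eq_sq_iff_eq_or_eq_neg.1 (hz.trans (one_pow 2).symm) with h | h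
    · left
      apply sphere_ext <;> simp [northPole, sph_x, sph_y, sph_z, h0, h1, h]
    · right
      apply sphere_ext <;> simp [southPole, sph_x, sph_y, sph_z, h0, h1, h]

theorem sphDen_sph (ε φ θ : ℝ) : sphDen ε (sph φ θ) = den (ε * Real.sin φ) θ := by
  rw [sphDen, den, sph_y, sph_z, cosHol_cos, ← sinHol_cos_mul_sin]
  ring

theorem sphScale_sph_sq {ε : ℝ} (hε : ε ∈ Set.Ioo 0 (1 / 2)) (φ θ : ℝ) :
    sphScale ε (sph φ θ) ^ 2 = (den (ε * Real.sin φ) θ)⁻¹ := by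
  rw [sphScale, inv_pow, Real.sq_sqrt (sphDen_pos hε _).le, sphDen_sph]

theorem hasParam_sphRep {ε : ℝ} (hε : ε ∈ Set.Ioo 0 (1 / 2)) (φ θ : ℝ) :
    HasParam ε (sphRep hε (sph φ θ)).cls φ θ (ε * Real.sin φ) := by
  have hk := sinHol_cos_mul_sin ε φ
  refine ⟨sphRep hε (sph φ θ), rfl, ?_⟩
  simp only [sphRep_apply, genVal]
  refine ⟨?_, ?_, ?_, ?_, ?_, ?_, ?_⟩
  · simp [unitZ, mkSU2, quat]
  · have : (negOne⁻¹).1 = -1 := by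
      simp [coe_eq_neg_one_iff, qre_inv, qx_inv, qy_inv, qz_inv, negOne, qre_mk, qx_mk, qy_mk,
        qz_mk]
    simp only [Submonoid.coe_mul, this]
    simp
  · obtain ⟨b0, b1, b2, b3⟩ := torusVal_b_coords hε (sph φ θ)
    refine (coe_eq_quat_iff (torusVal hε (sph φ θ) .b) _ _).2 ⟨b0, ?_, ?_, ?_⟩
    · simp only [b1, sph_y, sph_z, sphScale_sph_sq hε, cosHol_cos, Real.sin_two_mul, ← hk,
        Pi.smul_apply, smul_eq_mul, Matrix.cons_val]
      ring
    · simp [b2]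
    · simp only [b3, sph_y, sph_z, sphScale_sph_sq hε, cosHol_cos, ← hk,
        Pi.smul_apply, smul_eq_mul, Matrix.cons_val]
      ring
  · rw [Submonoid.coe_mul]
    congr 1
    refine (coe_eq_quat_iff _ _ _).2 ?_
    simp [lonVal, qre_mk, qx_mk, qy_mk, qz_mk, sph_x, sph_y, sph_z]
  · refine (coe_eq_quat_iff _ _ _).2 ?_
    simp only [merVal, qre_mk, qx_mk, qy_mk, qz_mk, sph_x, sph_y, sph_z, cosHol_cos, ← hk,
      Pi.smul_apply, smul_eq_mul, Matrix.cons_val]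
    refine ⟨trivial, ?_, ?_, ?_⟩ <;> ring
  · refine (coe_eq_quat_iff _ _ _).2 ?_
    simp only [hVal, qre_mk, qx_mk, qy_mk, qz_mk, sph_y, sph_z, cosHol_cos, ← hk,
      Pi.smul_apply, smul_eq_mul, Matrix.cons_val, sphScale, sphDen_sph]
    refine ⟨trivial, trivial, ?_, ?_⟩ <;> ring
  · simp [coe_eq_neg_one_iff, negOne, qre_mk, qx_mk, qy_mk, qz_mk]

/-! ### Coordinates on the image -/

/-- The torus relation turns `[A, B]` into `(ab)⁻¹`, so only the simple matrices `a` and `b` enter.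
The deficit from `1` vanishes exactly when `y = 0`. -/
theorem mu_restrict_sphRep {ε : ℝ} (hε : ε ∈ Set.Ioo 0 (1 / 2)) (p : S2) :
    mu (restrict ε (sphRep hε p).cls) =
      1 - 2 * (sphScale ε p * (sinHol ε (p.1 2) * p.1 1)) ^ 2 := by
  rw [restrict_cls, mu_cls]
  have hrel : tg .A * tg .B * (tg .A)⁻¹ * (tg .B)⁻¹ * tg .a * tg .b = 1 :=
    PresentedGroup.one_of_mem (rels := torusRels) rfl
  have : tg .A * tg .B * (tg .A)⁻¹ * (tg .B)⁻¹ = (tg .a * tg .b)⁻¹ :=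
    eq_inv_of_mul_eq_one_left (by rw [← hrel]; group)
  obtain ⟨a0, a1, a2, a3⟩ := torusVal_a_coords hε p
  obtain ⟨b0, b1, b2, b3⟩ := torusVal_b_coords hε p
  have D := sphScale_sq_mul hε p
  rw [this, map_inv, map_mul, restrict_sphRep_apply, restrict_sphRep_apply, qre_inv, qre_mul,
    a0, a1, a2, a3, b0, b1, b2, b3]
  linear_combination D

theorem restrict_sphRep_mem_P4 {ε : ℝ} (hε : ε ∈ Set.Ioo 0 (1 / 2)) {p : S2} (hp : p.1 1 ≠ 0) :
    restrict ε (sphRep hε p).cls ∈ P4 := by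
  have D := sphScale_sq_mul hε p
  have k := (sinHol_pos hε (p.1 2)).ne'
  have S := (sphScale_pos hε p).ne'
  have h1 : 0 < (sphScale ε p * (sinHol ε (p.1 2) * p.1 1)) ^ 2 := by positivity
  have h2 : 0 ≤ (sphScale ε p * cosHol ε (p.1 2)) ^ 2 := by positivity
  show mu _ ∈ Set.Ico (-1) 1
  rw [mu_restrict_sphRep]
  constructor <;> linarith

theorem restrict_sphRep_mem_P3 {ε : ℝ} (hε : ε ∈ Set.Ioo 0 (1 / 2)) {p : S2} (hp : p.1 1 = 0) :
    restrict ε (sphRep hε p).cls ∈ P3 := by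
  show mu _ = 1
  rw [mu_restrict_sphRep, hp]
  ring

/-- Conjugates of representations of the twice-punctured torus. -/
def torusConj (g : SU2) (ρ : TorusRep) : TorusRep :=
  ⟨(MulAut.conj g).toMonoidHom.comp ρ.hom, by
    constructor
    · refine (isTraceless_iff _).2 ((qre_conj g _).trans ?_)
      exact (isTraceless_iff _).1 ρ.cond.1
    · refine (isTraceless_iff _).2 ((qre_conj g _).trans ?_)
      exact (isTraceless_iff _).1 ρ.cond.2⟩

theorem torusConj_cls (g : SU2) (ρ : TorusRep) : (torusConj g ρ).cls = ρ.cls :=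
  (Rep.cls_eq_iff.2 ⟨g, fun _ => rfl⟩).symm

theorem torusConj_apply {ε : ℝ} (hε : ε ∈ Set.Ioo 0 (1 / 2)) (p : S2) (g : SU2) (i : TorusGen) :
    (torusConj g (restrictRep (sphRep hε p))).hom (tg i) = g * torusVal hε p i * g⁻¹ := by
  rw [← restrict_sphRep_apply]
  rfl

/-- For `y = 0` one has `h = iσ_x`, so `A` and `B` lie in the circle through `iσ_x`, while `a = iσ_z
= b⁻¹`. The frame `(iσ_z, s iσ_x)` exchanges these axes; the sign `s` allows `(α, β)` to be replaced
by `(-α, -β)`. -/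
theorem hasP3Coords_restrict_sphRep {ε : ℝ} (hε : ε ∈ Set.Ioo 0 (1 / 2)) {p : S2}
    (hp : p.1 1 = 0) {s α β : ℝ} (hs : s ^ 2 = 1) (hα : Real.cos α = -p.1 0)
    (hα' : Real.sin α = s * p.1 2) (hβ : Real.cos β = cosHol ε (p.1 2))
    (hβ' : Real.sin β = s * (sinHol ε (p.1 2) * p.1 0)) :
    HasP3Coords (restrict ε (sphRep hε p).cls) α β 0 := by
  obtain ⟨g, hg⟩ := exists_frame (e₁ := unitZ) (e₃ := mkSU2 0 s 0 0 (by rw [hs]; norm_num))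
    (qre_mk _ _ _ _ _) (qre_mk _ _ _ _ _)
    (by simp only [unitZ, qre_mul, qre_mk, qx_mk, qy_mk, qz_mk]; ring)
  obtain ⟨A0, A1, A2, A3⟩ := torusVal_A_coords hε p
  obtain ⟨B0, B1, B2, B3⟩ := torusVal_B_coords hε p
  obtain ⟨a0, a1, a2, a3⟩ := torusVal_a_coords hε p
  obtain ⟨b0, b1, b2, b3⟩ := torusVal_b_coords hε p
  have D := sphScale_sq_mul hε p
  have hq : sphScale ε p * cosHol ε (p.1 2) = 1 := by
    have Cp := cosHol_gt hε (p.1 2)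
    have Sp := sphScale_pos hε p
    rw [hp, mul_zero] at D
    refine (pow_left_inj₀ (by positivity) zero_le_one two_ne_zero).1 ?_
    linarith
  have hq2 : sphScale ε p ^ 2 * cosHol ε (p.1 2) ^ 2 = 1 := by rw [← mul_pow, hq, one_pow]
  refine ⟨torusConj g (restrictRep (sphRep hε p)), torusConj_cls _ _, ?_, ?_, ?_, ?_⟩
  · rw [torusConj_apply, coe_eq_quat_iff]
    obtain ⟨g0, g1, g2, g3⟩ := hg (torusVal hε p .A)
    rw [g0, g1, g2, g3]
    simp only [qre_mul, qx_mul, qy_mul, qz_mul, unitZ, qre_mk, qx_mk, qy_mk, qz_mk, A0, A1, A2,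
      A3, hp, hα, hα', Matrix.cons_val]
    refine ⟨?_, ?_, ?_, ?_⟩
    · linear_combination (-p.1 0) * hq
    · ring
    · ring
    · linear_combination s * p.1 2 * hq
  · rw [torusConj_apply, coe_eq_quat_iff]
    obtain ⟨g0, g1, g2, g3⟩ := hg (torusVal hε p .B)
    rw [g0, g1, g2, g3]
    simp only [qre_mul, qx_mul, qy_mul, qz_mul, unitZ, qre_mk, qx_mk, qy_mk, qz_mk, B0, B1, B2,
      B3, hp, hβ, hβ', Matrix.cons_val]
    refine ⟨trivial, ?_, ?_, ?_⟩ <;> ring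
  · rw [torusConj_apply, coe_eq_quat_iff]
    obtain ⟨g0, g1, g2, g3⟩ := hg (torusVal hε p .a)
    rw [g0, g1, g2, g3]
    simp [qre_mul, qx_mul, qy_mul, qz_mul, unitZ, qre_mk, qx_mk, qy_mk, qz_mk, a0, a1, a2, a3]
  · rw [torusConj_apply, torusConj_apply]
    have : torusVal hε p .b = (torusVal hε p .a)⁻¹ := by
      apply su2_ext <;>
        simp only [qre_inv, qx_inv, qy_inv, qz_inv, a0, a1, a2, a3, b0, b1, b2, b3, hp] <;>
        linarith
    rw [this]
    group

theorem exists_angle {x y : ℝ} (h : x ^ 2 + y ^ 2 = 1) :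
    ∃ α : ℝ, Real.cos α = x ∧ Real.sin α = y := by
  have hc : Real.cos (Real.arccos x) = x := Real.cos_arccos (by nlinarith) (by nlinarith)
  have hs := Real.cos_sq_add_sin_sq (Real.arccos x)
  rw [hc] at hs
  have : Real.sin (Real.arccos x) ^ 2 = y ^ 2 := by linarith
  rcases sq_eq_sq_iff_eq_or_eq_neg.1 this with h | h
  · exact ⟨_, hc, h⟩
  · exact ⟨-Real.arccos x, by rw [Real.cos_neg, hc], by rw [Real.sin_neg, h, neg_neg]⟩

theorem restrict_sphRep_mem_pillowcase {ε : ℝ} (hε : ε ∈ Set.Ioo 0 (1 / 2)) {p : S2}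
    (hp : p.1 1 = 0) : restrict ε (sphRep hε p).cls ∈ pillowcase := by
  have N := sphere_coords p
  rw [hp] at N
  have M := cosHol_sq_add ε (sphere_z_sq_le p)
  obtain ⟨α, h1, h2⟩ := exists_angle (x := -p.1 0) (y := 1 * p.1 2) (by linarith)
  obtain ⟨β, h3, h4⟩ := exists_angle (x := cosHol ε (p.1 2))
    (y := 1 * (sinHol ε (p.1 2) * p.1 0)) (by
      linear_combination M + sinHol ε (p.1 2) ^ 2 * N)
  exact ⟨restrict_sphRep_mem_P3 hε hp, α, β,
    hasP3Coords_restrict_sphRep hε hp (one_pow 2) h1 h2 h3 h4⟩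

/-! ### The representatives of points of `P₄` -/

theorem commute_of_scalar {g : SU2} (h1 : qx g = 0) (h2 : qy g = 0) (h3 : qz g = 0) (U : SU2) :
    g * U * g⁻¹ = U := by
  have : g * U = U * g := by
    apply su2_ext <;> simp only [qre_mul, qx_mul, qy_mul, qz_mul, h1, h2, h3] <;> ring
  rw [this, mul_inv_cancel_right]

/-- Equal traces force equal `β`. As `sin β ≠ 0`, a conjugating element preserves the `z`-axis with
its direction, hence is a rotation about it; as the `σ_x`-coefficients of both matrices `A` are
positive and their `σ_y`-coefficients vanish, it is scalar. -/
theorem HasP4Coords.unique {x : RT22} {a₁ b₁ a₂ b₂ : Fin 3 → ℝ} (h₁ : HasP4Coords x a₁ b₁)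
    (h₂ : HasP4Coords x a₂ b₂) : a₁ = a₂ ∧ b₁ = b₂ := by
  obtain ⟨ρ, hρ, r, hr, α, -, β, hβ, hA, hB, ha, hb⟩ := h₁
  obtain ⟨ρ', hρ', r', hr', α', -, β', hβ', hA', hB', ha', hb'⟩ := h₂
  obtain ⟨g, hg⟩ := Rep.cls_eq_iff.1 (hρ.trans hρ'.symm)
  have sqrt_pos : ∀ t ∈ Set.Ico (0 : ℝ) 1, 0 < Real.sqrt (1 - t ^ 2) := fun t ht =>
    Real.sqrt_pos.2 (by nlinarith [ht.1, ht.2])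
  have Sr := sqrt_pos r hr
  have Sr' := sqrt_pos r' hr'
  rw [coe_eq_quat_iff] at hA hB ha hb hA' hB' ha' hb'
  simp only [Matrix.cons_val] at hA hB hA' hB'
  obtain ⟨A0, A1, A2, A3⟩ := hA
  obtain ⟨B0, B1, B2, B3⟩ := hB
  obtain ⟨A0', A1', A2', A3'⟩ := hA'
  obtain ⟨B0', B1', B2', B3'⟩ := hB'
  have eA : ρ'.hom (tg .A) * g = g * ρ.hom (tg .A) := by rw [hg]; group
  have eB : ρ'.hom (tg .B) * g = g * ρ.hom (tg .B) := by rw [hg]; group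
  have hcos : Real.cos β' = Real.cos β := by rw [← B0, ← B0', hg, qre_conj]
  have hββ : β' = β := Real.injOn_cos ⟨hβ'.1.le, hβ'.2.le⟩ ⟨hβ.1.le, hβ.2.le⟩ hcos
  subst hββ
  have hsin := (Real.sin_pos_of_pos_of_lt_pi hβ.1 hβ.2).ne'
  have eBx := congrArg qx eB
  have eBy := congrArg qy eB
  simp only [qx_mul, qy_mul, B0, B1, B2, B3, B0', B1', B2', B3'] at eBx eBy
  have gx : qx g = 0 := (mul_eq_zero.1 (show Real.sin β' * qx g = 0 by linarith)).resolve_left hsin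
  have gy : qy g = 0 := (mul_eq_zero.1 (show Real.sin β' * qy g = 0 by linarith)).resolve_left hsin
  have eAy := congrArg qy eA
  simp only [qy_mul, A0, A1, A2, A3, A0', A1', A2', A3', gx, gy] at eAy
  have gz : qz g = 0 := (mul_eq_zero.1
    (show (Real.sqrt (1 - r ^ 2) + Real.sqrt (1 - r' ^ 2)) * qz g = 0 by linarith)).resolve_left
      (by positivity)
  have hgg : ∀ x, ρ'.hom x = ρ.hom x := fun x => (hg x).trans (commute_of_scalar gx gy gz _)
  rw [hgg] at ha' hb'
  constructor
  · ext i
    fin_cases i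
    exacts [ha.2.1.symm.trans ha'.2.1, ha.2.2.1.symm.trans ha'.2.2.1,
      ha.2.2.2.symm.trans ha'.2.2.2]
  · ext i
    fin_cases i
    exacts [hb.2.1.symm.trans hb'.2.1, hb.2.2.1.symm.trans hb'.2.2.1,
      hb.2.2.2.symm.trans hb'.2.2.2]

/-- This is the polar form of `c · exp(i(φ + π/2))` with nonnegative radius: a negative `c` shifts
the angle by `π`, and a further `2π` may be needed to land in `[0, 2π]`. -/
theorem exists_polar_angle {φ : ℝ} (hφ : φ ∈ Set.Ioo 0 Real.pi) (c : ℝ) :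
    ∃ α ∈ Set.Icc (0 : ℝ) (2 * Real.pi), |c| * Real.cos α = -(c * Real.sin φ) ∧
      |c| * Real.sin α = c * Real.cos φ := by
  obtain ⟨h0, h1⟩ := hφ
  rcases le_or_gt 0 c with h | h
  · refine ⟨φ + Real.pi / 2, ⟨by linarith, by linarith⟩, ?_, ?_⟩
    · rw [abs_of_nonneg h, Real.cos_add_pi_div_two]; ring
    · rw [abs_of_nonneg h, Real.sin_add_pi_div_two]
  · rcases le_or_gt (Real.pi / 2) φ with h2 | h2
    · refine ⟨φ - Real.pi / 2, ⟨by linarith, by linarith⟩, ?_, ?_⟩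
      · rw [abs_of_neg h, Real.cos_sub_pi_div_two]; ring
      · rw [abs_of_neg h, Real.sin_sub_pi_div_two]; ring
    · refine ⟨φ - Real.pi / 2 + 2 * Real.pi, ⟨by linarith, by linarith⟩, ?_, ?_⟩
      · rw [abs_of_neg h, Real.cos_add_two_pi, Real.cos_sub_pi_div_two]; ring
      · rw [abs_of_neg h, Real.sin_add_two_pi, Real.sin_sub_pi_div_two]; ring

/-- The normal form dictates the frame: `e₃` is the axis `(cos θ, sin θ, 0)` of `B`, and `e₁` is the
normalized component of `A` orthogonal to `e₃`. That component is `q sin θ` times a unit vector, `q`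
being the scale, so `s`, the sign of `sin θ`, makes its coefficient positive. -/
theorem hasP4Coords_restrict_sphRep {ε : ℝ} (hε : ε ∈ Set.Ioo 0 (1 / 2)) {φ θ s ν : ℝ}
    (hφ : φ ∈ Set.Ioo 0 Real.pi) (hs : s ^ 2 = 1) (hpos : 0 < s * Real.sin θ)
    (hν : ν = ε * Real.sin φ) :
    HasP4Coords (restrict ε (sphRep hε (sph φ θ)).cls)
      ![-(s * Real.sin (φ + ν)), -(s * Real.cos (φ + ν)), 0]
      ![s * ((den ν θ)⁻¹ * (Real.cos ν ^ 2 * Real.cos θ ^ 2 * Real.sin (φ + ν) +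
          Real.sin θ ^ 2 * Real.sin (φ - ν))),
        s * ((den ν θ)⁻¹ * (Real.cos ν ^ 2 * Real.cos θ ^ 2 * Real.cos (φ + ν) +
          Real.sin θ ^ 2 * Real.cos (φ - ν))),
        -(1 / 2) * (den ν θ)⁻¹ * Real.sin (2 * ν) * Real.sin (2 * θ)] := by
  have hUW := Real.cos_sq_add_sin_sq (φ + ν)
  have hθθ := Real.cos_sq_add_sin_sq θ
  have hνν := Real.cos_sq_add_sin_sq ν
  have hsin : 0 < Real.sin φ := Real.sin_pos_of_pos_of_lt_pi hφ.1 hφ.2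
  have hν0 : 0 < ν := hν ▸ mul_pos hε.1 hsin
  have hνπ : ν < Real.pi := by
    have := Real.sin_le_one φ
    rw [hν]
    nlinarith [hε.1, hε.2, Real.pi_gt_three]
  have hk : sinHol ε (Real.cos φ) * Real.sin φ = Real.sin ν := by rw [sinHol_cos_mul_sin, hν]
  have hC : cosHol ε (Real.cos φ) = Real.cos ν := by rw [cosHol_cos, hν]
  have hden : (den ν θ)⁻¹ = sphScale ε (sph φ θ) ^ 2 := by rw [sphScale_sph_sq hε, hν]
  have D := sphScale_sq_mul hε (sph φ θ)
  have Sp := sphScale_pos hε (sph φ θ)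
  obtain ⟨g, hg⟩ := exists_frame
    (e₁ := mkSU2 0 (s * Real.cos (φ + ν) * Real.sin θ) (-(s * Real.cos (φ + ν) * Real.cos θ))
      (-(s * Real.sin (φ + ν))) (by
        linear_combination s ^ 2 * Real.cos (φ + ν) ^ 2 * hθθ + s ^ 2 * hUW + hs))
    (e₃ := mkSU2 0 (Real.cos θ) (Real.sin θ) 0 (by linear_combination hθθ))
    (qre_mk _ _ _ _ _) (qre_mk _ _ _ _ _)
    (by simp only [qre_mul, qre_mk, qx_mk, qy_mk, qz_mk]; ring)
  obtain ⟨A0, A1, A2, A3⟩ := torusVal_A_coords hε (sph φ θ)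
  obtain ⟨B0, B1, B2, B3⟩ := torusVal_B_coords hε (sph φ θ)
  obtain ⟨a0, a1, a2, a3⟩ := torusVal_a_coords hε (sph φ θ)
  obtain ⟨b0, b1, b2, b3⟩ := torusVal_b_coords hε (sph φ θ)
  rw [hden]
  simp only [sph_x, sph_y, sph_z, hC] at A0 A1 A2 A3 B0 B1 B2 B3 b0 b1 b2 b3 D
  have hk' : ∀ t, sinHol ε (Real.cos φ) * (Real.sin φ * t) = Real.sin ν * t := fun t => by
    rw [← hk]; ring
  -- The angle `φ + ν` enters here, from multiplying `h` by the longitude.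
  have hkA : (Real.cos ν + sinHol ε (Real.cos φ) * Real.cos φ) * (Real.sin φ * Real.sin θ) =
      Real.sin (φ + ν) * Real.sin θ := by
    rw [Real.sin_add, ← hk]; ring
  simp only [hk', hkA] at A1 A2 A3 B1 B2 b1 b3 D
  generalize sphScale ε (sph φ θ) = q at *
  -- The real and `e₃` components of `A` are `q cos ν cos θ` times `(-sin φ, cos φ)`, so `r` is the
  -- absolute value of that factor.
  have hr2 : 1 - |q * Real.cos ν * Real.cos θ| ^ 2 = (q * (s * Real.sin θ)) ^ 2 := by
    rw [sq_abs]
    linear_combination (-1 : ℝ) * D - q ^ 2 * Real.sin θ ^ 2 * hs +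
      q ^ 2 * Real.cos ν ^ 2 * (-hθθ) + q ^ 2 * Real.sin θ ^ 2 * hνν
  have hsqrt : Real.sqrt (1 - |q * Real.cos ν * Real.cos θ| ^ 2) = q * (s * Real.sin θ) := by
    rw [hr2, Real.sqrt_sq (by positivity)]
  have hr : |q * Real.cos ν * Real.cos θ| < 1 := by
    have : 0 < (q * (s * Real.sin θ)) ^ 2 := by positivity
    refine (sq_lt_one_iff₀ (abs_nonneg _)).1 ?_
    linarith
  obtain ⟨α, hα, hα1, hα2⟩ := exists_polar_angle hφ (q * Real.cos ν * Real.cos θ)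
  refine ⟨torusConj g (restrictRep (sphRep hε (sph φ θ))), torusConj_cls _ _,
    |q * Real.cos ν * Real.cos θ|, ⟨abs_nonneg _, hr⟩, α, hα, ν, ⟨hν0, hνπ⟩, ?_, ?_, ?_, ?_⟩
  · rw [torusConj_apply, coe_eq_quat_iff]
    obtain ⟨g0, g1, g2, g3⟩ := hg (torusVal hε (sph φ θ) .A)
    rw [g0, g1, g2, g3, hsqrt, hα1, hα2]
    simp only [qre_mul, qx_mul, qy_mul, qz_mul, qre_mk, qx_mk, qy_mk, qz_mk, A0, A1, A2,
      A3, Matrix.cons_val]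
    refine ⟨?_, ?_, ?_, ?_⟩
    · ring
    · linear_combination q * s * Real.sin θ * hUW -
        q * s * Real.sin θ * Real.cos (φ + ν) * (Real.cos_add φ ν) -
        q * s * Real.sin θ * Real.cos (φ + ν) * Real.sin ν * Real.sin φ * hθθ
    · linear_combination q * s * Real.sin θ * Real.sin (φ + ν) * (Real.cos_add φ ν) +
        q * s * Real.sin θ * Real.sin (φ + ν) *
          (Real.sin ν * Real.sin φ + Real.cos (φ + ν)) * hθθ
    · ring
  · rw [torusConj_apply, coe_eq_quat_iff]
    obtain ⟨g0, g1, g2, g3⟩ := hg (torusVal hε (sph φ θ) .B)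
    rw [g0, g1, g2, g3]
    simp only [qre_mul, qx_mul, qy_mul, qz_mul, qre_mk, qx_mk, qy_mk, qz_mk, B0, B1, B2,
      B3, Matrix.cons_val]
    refine ⟨trivial, ?_, ?_, ?_⟩
    · ring
    · ring
    · linear_combination Real.sin ν * hθθ
  · rw [torusConj_apply, coe_eq_quat_iff]
    obtain ⟨g0, g1, g2, g3⟩ := hg (torusVal hε (sph φ θ) .a)
    rw [g0, g1, g2, g3]
    simp only [qre_mul, qx_mul, qy_mul, qz_mul, qre_mk, qx_mk, qy_mk, qz_mk, a0, a1, a2,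
      a3, Matrix.cons_val]
    refine ⟨trivial, ?_, ?_, ?_⟩
    · ring
    · linear_combination (-(s * Real.cos (φ + ν))) * hθθ
    · ring
  · rw [torusConj_apply, coe_eq_quat_iff]
    obtain ⟨g0, g1, g2, g3⟩ := hg (torusVal hε (sph φ θ) .b)
    rw [g0, g1, g2, g3]
    simp only [qre_mul, qx_mul, qy_mul, qz_mul, qre_mk, qx_mk, qy_mk, qz_mk, b0, b1, b2,
      b3, Matrix.cons_val, Real.sin_two_mul, Real.sin_add, Real.cos_add, Real.sin_sub,
      Real.cos_sub]
    refine ⟨trivial, ?_, ?_, ?_⟩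
    · linear_combination s * q ^ 2 *
        (-(Real.sin φ * Real.cos ν + Real.cos φ * Real.sin ν) * Real.cos ν ^ 2 * hθθ +
          Real.sin θ ^ 2 * (Real.sin φ * Real.cos ν - Real.cos φ * Real.sin ν) * hνν)
    · linear_combination s * q ^ 2 *
        (-(Real.cos φ * Real.cos ν - Real.sin φ * Real.sin ν) *
            (Real.sin ν ^ 2 * Real.sin θ ^ 2) * hθθ +
          Real.sin θ ^ 2 * (Real.cos φ * Real.cos ν + Real.sin φ * Real.sin ν) * hνν)
    · ring

end PerturbedCharVar

/-! ### Assembly of the theorem -/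

theorem mainTheorem5 :
    ∃ ε₀ : ℝ, 0 < ε₀ ∧ ∀ ε : ℝ, 0 < ε → ε < ε₀ →
      ∃ Φ : S2 ≃ₜ RPert ε,
        -- the homeomorphism is given by the explicit matrices
        (∀ φ ∈ Set.Icc (0 : ℝ) Real.pi, ∀ θ ∈ Set.Icc (0 : ℝ) (2 * Real.pi),
          HasParam ε (Φ (sph φ θ)) φ θ (ε * Real.sin φ)) ∧
        -- the map to `R(T², 2)` is injective except that the two poles have the same image
        (∀ p q : S2, restrict ε (Φ p) = restrict ε (Φ q) ↔
          p = q ∨ ((p = northPole ∨ p = southPole) ∧ (q = northPole ∨ q = southPole))) ∧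
        -- the image consists of nonabelian representations
        (∀ x ∈ sphereLagrangian ε, x.IsNonabelian) ∧
        -- the part of the image with `y ≠ 0`
        (∀ p : S2, p.1 1 ≠ 0 → restrict ε (Φ p) ∈ P4) ∧
        (∀ φ ∈ Set.Ioo (0 : ℝ) Real.pi, ∀ θ ∈ Set.Ioo (0 : ℝ) Real.pi,
          ∀ ν : ℝ, ν = ε * Real.sin φ → ∀ ahat bhat : Fin 3 → ℝ,
            HasP4Coords (restrict ε (Φ (sph φ θ))) ahat bhat ↔
              ahat = ![-Real.sin (φ + ν), -Real.cos (φ + ν), 0] ∧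
              bhat =
                ![(den ν θ)⁻¹ * (Real.cos ν ^ 2 * Real.cos θ ^ 2 * Real.sin (φ + ν) +
                    Real.sin θ ^ 2 * Real.sin (φ - ν)),
                  (den ν θ)⁻¹ * (Real.cos ν ^ 2 * Real.cos θ ^ 2 * Real.cos (φ + ν) +
                    Real.sin θ ^ 2 * Real.cos (φ - ν)),
                  -(1 / 2) * (den ν θ)⁻¹ * Real.sin (2 * ν) * Real.sin (2 * θ)]) ∧
        (∀ φ ∈ Set.Ioo (0 : ℝ) Real.pi, ∀ θ ∈ Set.Ioo Real.pi (2 * Real.pi),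
          ∀ ν : ℝ, ν = ε * Real.sin φ → ∀ ahat bhat : Fin 3 → ℝ,
            HasP4Coords (restrict ε (Φ (sph φ θ))) ahat bhat ↔
              ahat = ![Real.sin (φ + ν), Real.cos (φ + ν), 0] ∧
              bhat =
                ![-(den ν θ)⁻¹ * (Real.cos ν ^ 2 * Real.cos θ ^ 2 * Real.sin (φ + ν) +
                    Real.sin θ ^ 2 * Real.sin (φ - ν)),
                  -(den ν θ)⁻¹ * (Real.cos ν ^ 2 * Real.cos θ ^ 2 * Real.cos (φ + ν) +
                    Real.sin θ ^ 2 * Real.cos (φ - ν)),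
                  -(1 / 2) * (den ν θ)⁻¹ * Real.sin (2 * ν) * Real.sin (2 * θ)]) ∧
        -- the part of the image with `y = 0`
        (∀ p : S2, p.1 1 = 0 → restrict ε (Φ p) ∈ pillowcase) ∧
        (∀ φ ∈ Set.Icc (0 : ℝ) Real.pi,
          HasP3Coords (restrict ε (Φ (sph φ 0))) (φ + Real.pi / 2) (ε * Real.sin φ) 0 ∧
          HasP3Coords (restrict ε (Φ (sph φ Real.pi))) (φ - Real.pi / 2) (ε * Real.sin φ) 0) ∧
        HasP3Coords (restrict ε (Φ northPole)) (Real.pi / 2) 0 0 ∧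
        HasP3Coords (restrict ε (Φ southPole)) (Real.pi / 2) 0 0 := by

  refine ⟨1 / 2, by norm_num, fun ε h0 h1 => ?_⟩
  have hε : ε ∈ Set.Ioo 0 (1 / 2) := ⟨h0, h1⟩
  obtain ⟨Φ, hΦ⟩ := exists_sphHomeo hε
  refine ⟨Φ, ?_, ?_, ?_, ?_, ?_, ?_, ?_, ?_, ?_, ?_⟩
  · intro φ _ θ _
    rw [hΦ]
    exact hasParam_sphRep hε φ θ
  · intro p q
    rw [hΦ, hΦ, eq_pole_iff, eq_pole_iff]
    refine ⟨eq_or_poles_of_restrict_eq hε, ?_⟩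
    rintro (rfl | ⟨hp, hq⟩)
    · rfl
    · exact restrict_sphRep_eq_of_poles hε hp.1 hp.2 hq.1 hq.2
  · rintro _ ⟨x, rfl⟩
    obtain ⟨p, rfl⟩ := Φ.surjective x
    rw [hΦ]
    exact isNonabelian_restrict_sphRep hε p
  · intro p hp
    rw [hΦ]
    exact restrict_sphRep_mem_P4 hε hp
  · intro φ hφ θ hθ ν hν ahat bhat
    rw [hΦ]
    -- Existence of the normal form gives one implication, its uniqueness the other.
    have h := hasP4Coords_restrict_sphRep hε hφ (one_pow 2)
      (by rw [one_mul]; exact Real.sin_pos_of_pos_of_lt_pi hθ.1 hθ.2) hν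
    simp only [one_mul] at h
    refine ⟨fun h' => h'.unique h, ?_⟩
    rintro ⟨rfl, rfl⟩
    exact h
  · intro φ hφ θ hθ ν hν ahat bhat
    rw [hΦ]
    have h := hasP4Coords_restrict_sphRep (s := -1) (θ := θ) hε hφ (by norm_num) (by
      have := Real.sin_pos_of_pos_of_lt_pi (x := θ - Real.pi) (by linarith [hθ.1])
        (by linarith [hθ.2])
      rw [Real.sin_sub_pi] at this
      linarith) hν
    simp only [neg_one_mul, neg_neg, ← neg_mul] at h ⊢
    refine ⟨fun h' => h'.unique h, ?_⟩
    rintro ⟨rfl, rfl⟩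
    exact h
  · intro p hp
    rw [hΦ]
    exact restrict_sphRep_mem_pillowcase hε hp
  · intro φ _
    rw [hΦ, hΦ]
    constructor
    · refine hasP3Coords_restrict_sphRep (s := 1) hε ?_ ?_ ?_ ?_ ?_ ?_ <;>
        simp [sph_x, sph_y, sph_z, cosHol_cos, sinHol_cos_mul_sin, Real.cos_add_pi_div_two,
          Real.sin_add_pi_div_two]
    · refine hasP3Coords_restrict_sphRep (s := -1) hε ?_ ?_ ?_ ?_ ?_ ?_ <;>
        simp [sph_x, sph_y, sph_z, cosHol_cos, sinHol_cos_mul_sin, Real.cos_sub_pi_div_two,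
          Real.sin_sub_pi_div_two]
  · rw [hΦ]
    refine hasP3Coords_restrict_sphRep (s := 1) hε ?_ ?_ ?_ ?_ ?_ ?_ <;>
      simp [northPole, sph_x, sph_y, sph_z, cosHol]
  · rw [hΦ]
    -- The sign `-1` compensates `z = -1`, so that both poles receive `α = π/2`.
    refine hasP3Coords_restrict_sphRep (s := -1) hε ?_ ?_ ?_ ?_ ?_ ?_ <;>
      simp [southPole, sph_x, sph_y, sph_z, cosHol]
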